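/- Everything is of class $C^\infty$, and submanifolds are embedded. A Jacobi structure on a manifold $M$ is a pair $(\Lambda,E)$ of a bivector field and a vector field such that $\{f,g\}=\Lambda(df,dg)+f\,Eg-g\,Ef$ is a Lie algebra bracket on $C^\infty(M)$. Let $(M,\Lambda,E)$ be a Jacobi manifold and let $N\subseteq M$ be a submanifold with a normalization, i.e. a smooth vector bundle $\nu N\subseteq TM|_N$ with $TM|_N=TN\oplus\nu N$; let $p_T:TM|_N\to TN$ be the corresponding projection and $\mathrm{ann}(\nu N)\subseteq T^*M|_N$ the annihilator of $\nu N$. A vector field $X$ on $M$ is called normal to $N$ if $X|_N\in\Gamma(\nu N)$. Say that - $\Lambda$ (resp. $E$) is algebraically compatible with $(N,\nu N)$ if $i(\alpha)\Lambda$ is tangent to $N$ for all $x\in N$ and $\alpha\in\mathrm{ann}(\nu_xN)$ (resp. if $E|_N$ is tangent to $N$); - $\Lambda$ (resp. $E$) is quasi-soldered to $(N,\nu N)$ if $(L_X\Lambda)|_{\mathrm{ann}(\nu N)}=0$ (resp. $[X,E]|_{\mathrm{ann}(\nu N)}=0$) for every vector field $X$ on $M$ normal to $N$; - $(N,\nu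 N)$ is almost Dirac if $\Lambda$ is algebraically compatible and quasi-soldered; algebraically Jacobi-compatible (a.J.c.) if $\Lambda$ and $E$ are algebraically compatible; quasi-Dirac if $\Lambda$ and $E$ are quasi-soldered; - $(N,\nu N)$ is quasi-Dirac in coordinates if each point of $N$ lies in the domain of a chart $(x^a,y^u)$ of $M$ in which $N$ is given by $x^a=0$, $\nu N$ is spanned along $N$ by the $\partial/\partial x^a$, and, along $N$, $\partial\Lambda^{uv}/\partial x^a=0$ and $\partial E^u/\partial x^a=0$ for all $a,u,v$, where $\Lambda^{uv}=\Lambda(dy^u,dy^v)$ and $E^u=dy^u(E)$. **Proposition 3.1.** If $(N,\nu N)$ is almost Dirac, a.J.c., quasi-Dirac, or quasi-Dirac in coordinates, then $\Lambda'=p_T(\Lambda|_N)$ and $E'=p_T(E|_N)$ form a Jacobi structure on $N$. Moreover, if $\nu N$ and $\tilde\nu N$ are two normalizations of $N$, each of which is almost Dirac or a.J.c., then they define the same bivector field $\Lambda'$ on $N$. -/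

import Mathlib

open scoped Manifold ContDiff Topology

noncomputable section

namespace JacobiGeometry

section Jacobi

variable {m : ℕ} {M : Type*} [TopologicalSpace M] [ChartedSpace (EuclideanSpace ℝ (Fin m)) M]

/-- Cotangent vectors of the `m`-manifold `M` at `x`. -/
abbrev Covector (m : ℕ) {M : Type*} [TopologicalSpace M]
    [ChartedSpace (EuclideanSpace ℝ (Fin m)) M] (x : M) : Type :=
  TangentSpace (𝓡 m) x →L[ℝ] ℝ

/-- The differential of a real function. -/
abbrev dif (m : ℕ) {M : Type*} [TopologicalSpace M]
    [ChartedSpace (EuclideanSpace ℝ (Fin m)) M] (f : M → ℝ) (x : M) : Covector m x :=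
  mvfderiv (𝓡 m) f x

/-- Smooth real functions on `M`. -/
def IsSmooth (m : ℕ) {M : Type*} [TopologicalSpace M]
    [ChartedSpace (EuclideanSpace ℝ (Fin m)) M] (f : M → ℝ) : Prop :=
  ContMDiff (𝓡 m) 𝓘(ℝ, ℝ) ∞ f

/-- A (not necessarily smooth) field of tangent vectors. -/
abbrev VField (m : ℕ) (M : Type*) [TopologicalSpace M]
    [ChartedSpace (EuclideanSpace ℝ (Fin m)) M] : Type _ :=
  ∀ x : M, TangentSpace (𝓡 m) x

/-- A (not necessarily smooth or skew) field of bilinear forms on the cotangent spaces. -/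
abbrev BivField (m : ℕ) (M : Type*) [TopologicalSpace M]
    [ChartedSpace (EuclideanSpace ℝ (Fin m)) M] : Type _ :=
  ∀ x : M, Covector m x →ₗ[ℝ] Covector m x →ₗ[ℝ] ℝ

/-- Smooth vector fields: smooth sections of the tangent bundle. -/
def IsVectorField [IsManifold (𝓡 m) ∞ M] (X : VField m M) : Prop :=
  ContMDiff (𝓡 m) (𝓡 m).tangent ∞ (fun x ↦ (⟨x, X x⟩ : TangentBundle (𝓡 m) M))

/-- Smooth bivector fields: an element of `⋀² T_x M` is an alternating bilinear form on
`T*_x M`, and such a field is smooth iff its value on any two exact forms is a smooth function. -/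
structure IsBivectorField (Λ : BivField m M) : Prop where
  alternating : ∀ (x : M) (α : Covector m x), Λ x α α = 0
  smooth : ∀ f g : M → ℝ, IsSmooth m f → IsSmooth m g →
    IsSmooth m (fun x ↦ Λ x (dif m f x) (dif m g x))

/-- The bracket `{f, g} = Λ(df, dg) + f E g - g E f`. -/
def jacobiBracket (Λ : BivField m M) (E : VField m M) (f g : M → ℝ) : M → ℝ :=
  fun x ↦ Λ x (dif m f x) (dif m g x) + f x * dif m g x (E x) - g x * dif m f x (E x)

/-- `(Λ, E)` is a Jacobi structure: a smooth bivector field and a smooth vector field whose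
bracket `{f, g} = Λ(df, dg) + f E g - g E f` is a Lie algebra bracket on `C^∞(M)`
(bilinearity and skew-symmetry hold automatically). -/
structure IsJacobiStructure [IsManifold (𝓡 m) ∞ M] (Λ : BivField m M) (E : VField m M) :
    Prop where
  isBivectorField : IsBivectorField Λ
  isVectorField : IsVectorField E
  jacobi : ∀ f g h : M → ℝ, IsSmooth m f → IsSmooth m g → IsSmooth m h → ∀ x : M,
    jacobiBracket Λ E (jacobiBracket Λ E f g) h x
      + jacobiBracket Λ E (jacobiBracket Λ E g h) f x
      + jacobiBracket Λ E (jacobiBracket Λ E h f) g x = 0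

/-- The Lie derivative of a bivector field, evaluated on exact forms:
`(L_X Λ)(df, dg) = X(Λ(df, dg)) - Λ(d(Xf), dg) - Λ(df, d(Xg))`. -/
def lieDerivBivector (X : VField m M) (Λ : BivField m M) (f g : M → ℝ) (x : M) : ℝ :=
  dif m (fun z ↦ Λ z (dif m f z) (dif m g z)) x (X x)
    - Λ x (dif m (fun z ↦ dif m f z (X z)) x) (dif m g x)
    - Λ x (dif m f x) (dif m (fun z ↦ dif m g z (X z)) x)

end Jacobi

section Submanifold

variable {n m : ℕ}
  {N : Type*} [TopologicalSpace N] [ChartedSpace (EuclideanSpace ℝ (Fin n)) N]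
  {M : Type*} [TopologicalSpace M] [ChartedSpace (EuclideanSpace ℝ (Fin m)) M]

/-- A normalization of the submanifold `ι : N → M`: a smooth subbundle `νN` of `TM|_N` with
`TM|_N = TN ⊕ νN`. Smoothness: `νN` has smooth local frames. -/
structure Normalization (n m : ℕ)
    {N : Type*} [TopologicalSpace N] [ChartedSpace (EuclideanSpace ℝ (Fin n)) N]
    {M : Type*} [TopologicalSpace M] [ChartedSpace (EuclideanSpace ℝ (Fin m)) M]
    [IsManifold (𝓡 m) ∞ M] (ι : N → M) where
  /-- The fibre `ν_x N`. -/
  fiber : ∀ x : N, Submodule ℝ (TangentSpace (𝓡 m) (ι x))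
  isCompl : ∀ x : N,
    IsCompl (LinearMap.range (mfderiv (𝓡 n) (𝓡 m) ι x).toLinearMap) (fiber x)
  exists_frame : ∀ x₀ : N, ∃ U ∈ 𝓝 x₀, ∃ (k : ℕ)
    (s : Fin k → ∀ x : N, TangentSpace (𝓡 m) (ι x)),
    (∀ i, ContMDiffOn (𝓡 n) (𝓡 m).tangent ∞
      (fun x ↦ (⟨ι x, s i x⟩ : TangentBundle (𝓡 m) M)) U) ∧
    ∀ x ∈ U, LinearIndependent ℝ (fun i ↦ s i x) ∧
      Submodule.span ℝ (Set.range fun i ↦ s i x) = fiber x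

/-- The differential of a smooth embedding is injective. -/
theorem mfderiv_injective [IsManifold (𝓡 n) ∞ N] [IsManifold (𝓡 m) ∞ M] {ι : N → M}
    (hι : Manifold.IsSmoothEmbedding (𝓡 n) (𝓡 m) ∞ ι) (x : N) :
    Function.Injective (mfderiv (𝓡 n) (𝓡 m) ι x).toLinearMap := by
  have h := hι.isImmersion.isImmersionAt x
  have hx := h.mem_domChart_source
  have hy := h.mem_codChart_source
  let r : M → N := fun z ↦ h.domChart.symm (h.equiv.symm (h.codChart z)).1
  have hloc : ∀ z ∈ h.domChart.source,
      (h.equiv.symm (h.codChart (ι z))).1 = h.domChart z := by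
    intro z hz
    have hm : h.domChart z ∈ (h.domChart.extend (𝓡 n)).target := by
      simpa [OpenPartialHomeomorph.extend_target] using h.domChart.map_source hz
    have h1 := h.writtenInCharts hm
    simp only [Function.comp_apply, OpenPartialHomeomorph.extend_coe,
      OpenPartialHomeomorph.extend_coe_symm, modelWithCornersSelf_coe,
      modelWithCornersSelf_coe_symm, id, h.domChart.left_inv hz] at h1
    simp [h1]
  have hr : MDifferentiableAt (𝓡 m) (𝓡 n) r (ι x) := by
    have h1 : MDifferentiableAt (𝓡 m) (𝓡 m) h.codChart (ι x) :=
      ((contMDiffOn_of_mem_maximalAtlas h.codChart_mem_maximalAtlas).contMDiffAt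
        (h.codChart.open_source.mem_nhds hy)).mdifferentiableAt (by simp)
    have h2 : MDifferentiableAt (𝓡 m) (𝓡 n)
        (fun v : EuclideanSpace ℝ (Fin m) ↦ (h.equiv.symm v).1) (h.codChart (ι x)) := by
      rw [mdifferentiableAt_iff_differentiableAt]
      fun_prop
    have h3 : MDifferentiableAt (𝓡 n) (𝓡 n) h.domChart.symm
        (h.equiv.symm (h.codChart (ι x))).1 := by
      rw [hloc x hx]
      exact ((contMDiffOn_symm_of_mem_maximalAtlas h.domChart_mem_maximalAtlas).contMDiffAt
        (h.domChart.open_target.mem_nhds (h.domChart.map_source hx))).mdifferentiableAt (by simp)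
    have h4 : MDifferentiableAt (𝓡 m) (𝓡 n)
        (fun v : EuclideanSpace ℝ (Fin m) ↦ h.domChart.symm (h.equiv.symm v).1)
        (h.codChart (ι x)) :=
      MDifferentiableAt.comp (I' := 𝓡 n) (f := fun v : EuclideanSpace ℝ (Fin m) ↦
        (h.equiv.symm v).1) _ h3 h2
    exact MDifferentiableAt.comp (I' := 𝓡 m) (f := h.codChart) (ι x) h4 h1
  have hid : r ∘ ι =ᶠ[𝓝 x] id := by
    filter_upwards [h.domChart.open_source.mem_nhds hx] with z hz
    simp [r, hloc z hz, h.domChart.left_inv hz]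
  have hιd : MDifferentiableAt (𝓡 n) (𝓡 m) ι x :=
    hι.contMDiff.contMDiffAt.mdifferentiableAt (by simp)
  have hcomp := mfderiv_comp x hr hιd
  rw [hid.mfderiv_eq, mfderiv_id] at hcomp
  intro v w hvw
  have hv := congrArg (fun L ↦ L v) hcomp
  have hw := congrArg (fun L ↦ L w) hcomp
  have hvw' : mfderiv (𝓡 n) (𝓡 m) ι x v = mfderiv (𝓡 n) (𝓡 m) ι x w := hvw
  exact hv.trans ((congrArg (mfderiv (𝓡 m) (𝓡 n) r (ι x)) hvw').trans hw.symm)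

variable [IsManifold (𝓡 n) ∞ N] [IsManifold (𝓡 m) ∞ M] {ι : N → M}

/-- The projection `p_T : T_{ι x} M → T_x N` along `ν_x N`, where `T_x N` is identified with its
image under the differential of `ι`. -/
def Normalization.pT (hι : Manifold.IsSmoothEmbedding (𝓡 n) (𝓡 m) ∞ ι)
    (ν : Normalization n m ι) (x : N) :
    TangentSpace (𝓡 m) (ι x) →L[ℝ] TangentSpace (𝓡 n) x :=
  haveI : FiniteDimensional ℝ (TangentSpace (𝓡 m) (ι x)) :=
    inferInstanceAs (FiniteDimensional ℝ (EuclideanSpace ℝ (Fin m)))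
  haveI : T2Space (TangentSpace (𝓡 m) (ι x)) :=
    inferInstanceAs (T2Space (EuclideanSpace ℝ (Fin m)))
  LinearMap.toContinuousLinearMap
    (LinearMap.linearProjOfIsCompl (ν.fiber x) (mfderiv (𝓡 n) (𝓡 m) ι x).toLinearMap
      (mfderiv_injective hι x) (ν.isCompl x))

/-- `E' = p_T(E|_N)`. -/
def Normalization.inducedVector (hι : Manifold.IsSmoothEmbedding (𝓡 n) (𝓡 m) ∞ ι)
    (ν : Normalization n m ι) (E : VField m M) : VField n N :=
  fun x ↦ ν.pT hι x (E (ι x))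

/-- `Λ' = p_T(Λ|_N)`: the push-forward of `Λ_{ι x}` by `p_T`, i.e.
`Λ'_x(α, β) = Λ_{ι x}(α ∘ p_T, β ∘ p_T)`. -/
def Normalization.inducedBivector (hι : Manifold.IsSmoothEmbedding (𝓡 n) (𝓡 m) ∞ ι)
    (ν : Normalization n m ι) (Λ : BivField m M) : BivField n N :=
  fun x ↦ LinearMap.mk₂ ℝ (fun α β ↦ Λ (ι x) (α.comp (ν.pT hι x)) (β.comp (ν.pT hι x)))
    (fun α₁ α₂ β ↦ by simp [ContinuousLinearMap.add_comp])
    (fun c α β ↦ by simp [ContinuousLinearMap.smul_comp])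
    (fun α β₁ β₂ ↦ by simp [ContinuousLinearMap.add_comp])
    (fun c α β ↦ by simp [ContinuousLinearMap.smul_comp])

/-- The covector `α` belongs to `ann(ν_x N)`. -/
def Normalization.InAnn (ν : Normalization n m ι) (x : N) (α : Covector m (ι x)) : Prop :=
  ∀ w ∈ ν.fiber x, α w = 0

/-- A smooth vector field on `M` that is normal to `N`. -/
def Normalization.IsNormalField (ν : Normalization n m ι) (X : VField m M) : Prop :=
  IsVectorField X ∧ ∀ x : N, X (ι x) ∈ ν.fiber x

/-- `Λ` is algebraically compatible with the normalization: `i(α)Λ` is tangent to `N` along `N`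
for every `α` in `ann(νN)`. -/
def Normalization.CompatBivector (ν : Normalization n m ι) (Λ : BivField m M) : Prop :=
  ∀ (x : N) (α : Covector m (ι x)), ν.InAnn x α →
    ∃ v : TangentSpace (𝓡 n) x, ∀ β : Covector m (ι x),
      Λ (ι x) α β = β (mfderiv (𝓡 n) (𝓡 m) ι x v)

/-- `E` is algebraically compatible with the normalization: it is tangent to `N` along `N`. -/
def Normalization.CompatVector (_ν : Normalization n m ι) (E : VField m M) : Prop :=
  ∀ x : N, ∃ v : TangentSpace (𝓡 n) x, E (ι x) = mfderiv (𝓡 n) (𝓡 m) ι x v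

/-- `Λ` is quasi-soldered: `(L_X Λ)|_{ann(νN)} = 0` for all vector fields `X` normal to `N`.
(Every covector is the differential of a smooth function.) -/
def Normalization.QuasiSolderedBivector (ν : Normalization n m ι) (Λ : BivField m M) : Prop :=
  ∀ X : VField m M, ν.IsNormalField X → ∀ (x : N) (f g : M → ℝ), IsSmooth m f → IsSmooth m g →
    ν.InAnn x (dif m f (ι x)) → ν.InAnn x (dif m g (ι x)) →
    lieDerivBivector X Λ f g (ι x) = 0

/-- `E` is quasi-soldered: `[X, E]|_{ann(νN)} = 0` for all vector fields `X` normal to `N`. -/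
def Normalization.QuasiSolderedVector (ν : Normalization n m ι) (E : VField m M) : Prop :=
  ∀ X : VField m M, ν.IsNormalField X → ∀ (x : N) (α : Covector m (ι x)), ν.InAnn x α →
    α (VectorField.mlieBracket (𝓡 m) X E (ι x)) = 0

/-- `(N, νN)` is almost Dirac: `Λ` is soldered to it. -/
def Normalization.IsAlmostDirac (ν : Normalization n m ι) (Λ : BivField m M) : Prop :=
  ν.CompatBivector Λ ∧ ν.QuasiSolderedBivector Λ

/-- `(N, νN)` is algebraically Jacobi-compatible. -/
def Normalization.IsAJC (ν : Normalization n m ι) (Λ : BivField m M) (E : VField m M) : Prop :=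
  ν.CompatBivector Λ ∧ ν.CompatVector E

/-- `(N, νN)` is quasi-Dirac: `Λ` and `E` are quasi-soldered to it. -/
def Normalization.IsQuasiDirac (ν : Normalization n m ι) (Λ : BivField m M) (E : VField m M) :
    Prop :=
  ν.QuasiSolderedBivector Λ ∧ ν.QuasiSolderedVector E

/-- Adapted local coordinates: a chart `φ` of `M` whose coordinates are split into
`y^u = φ_u` (`u ∈ S`) and `x^a = φ_a` (`a ∉ S`) such that `N` is given by `x^a = 0` and, along `N`,
the `dy^u` vanish on `νN`; thus `TN` and `νN` are spanned along `N` by the `∂/∂y^u` and the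
`∂/∂x^a`, respectively. -/
structure Normalization.IsAdaptedChart (ν : Normalization n m ι)
    (φ : OpenPartialHomeomorph M (EuclideanSpace ℝ (Fin m))) (S : Set (Fin m)) : Prop where
  mem_maximalAtlas : φ ∈ IsManifold.maximalAtlas (𝓡 m) ∞ M
  mem_range_iff : ∀ z ∈ φ.source, z ∈ Set.range ι ↔ ∀ a ∉ S, φ z a = 0
  normal : ∀ x : N, ι x ∈ φ.source → ∀ u ∈ S, ν.InAnn x (dif m (fun z ↦ φ z u) (ι x))

/-- The quasi-Dirac condition in coordinates: around each point of `N` there are adapted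
coordinates with `∂Λ^{uv}/∂x^a = 0` and `∂E^u/∂x^a = 0` along `N`, where
`Λ^{uv} = Λ(dy^u, dy^v)`, `E^u = dy^u(E)`, and the `∂/∂x^a` span `νN` along `N`. -/
def Normalization.IsCoordQuasiDirac (ν : Normalization n m ι) (Λ : BivField m M)
    (E : VField m M) : Prop :=
  ∀ x₀ : N, ∃ (φ : OpenPartialHomeomorph M (EuclideanSpace ℝ (Fin m))) (S : Set (Fin m)),
    ν.IsAdaptedChart φ S ∧ ι x₀ ∈ φ.source ∧
    ∀ x : N, ι x ∈ φ.source →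
      (∀ u ∈ S, ∀ v ∈ S, ν.InAnn x
        (dif m (fun z ↦ Λ z (dif m (fun p ↦ φ p u) z) (dif m (fun p ↦ φ p v) z)) (ι x))) ∧
      (∀ u ∈ S, ν.InAnn x (dif m (fun z ↦ dif m (fun p ↦ φ p u) z (E z)) (ι x)))

end Submanifold

end JacobiGeometry

end

/-!
Near each point of `N` there are coordinates `(x^a, y^u)` of `M` in which `N` is `x^a = 0` and `νN`
is spanned along `N` by the `∂/∂x^a`: if `sᵢ` is a local frame of `νN`, invert the map
`(v, c) ↦ v + ∑ cᵢ sᵢ(v)` (`Normalization.exists_isAdaptedChart`). If a function `f` on `N` is extended locally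
to a function `F` of the `y^u` alone (`Normalization.IsAdaptedChart.exists_isAdaptedExtension`),
then `dF = df ∘ p_T` along `N`. Hence `Λ'(df, dg) = Λ(dF, dG)` and `E'f = dF(E)` on `N`, which
gives the smoothness of `Λ'` and `E'`, and `{f, g}' = {F, G}` on `N`. The function `K = {F, G}`
extends `{f, g}'`, but `dK` need not annihilate `νN`, so that `{K, H}` and `{{f, g}', h}'` may
differ on `N`: the difference consists of `Λ(dK - dk ∘ p_T, dH)`, with `k = {f, g}'`, and of
`h · dK(Q)`, up to sign, where `Q` is the component of `E` along `νN`
(`Normalization.jacobiBracket_induced_eq`).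

* If `Λ` is algebraically compatible, the first term vanishes because `Λ(·, dH)` is tangent to `N`.
  If `E` is algebraically compatible too, `Q = 0`.
* If `Λ` is quasi-soldered, testing this on the fields `∂/∂x^a`, which annihilate the `y^u`, gives
  `∂Λ^{uv}/∂x^a = 0` along `N`; then `dK(Q) = f A_g - g A_f` with `A_f = d(dF(E))(Q)`, and the
  cyclic sum of `h (f A_g - g A_f)` is zero.
* If `E` is also quasi-soldered, then likewise `∂E^u/∂x^a = 0` along `N`; thus quasi-Dirac implies
  quasi-Dirac in coordinates, and in the latter case `dK` annihilates `νN` after all.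

So the Jacobi identity passes from `M` to `N` in all four cases
(`Normalization.IsAdaptedChart.jacobi_induced`). That two normalizations to which `Λ` is
algebraically compatible induce the same `Λ'` is linear algebra at each point
(`Normalization.inducedBivector_eq_of_compat`).
-/

noncomputable section

namespace JacobiGeometry

/-! ### Differentials and smooth functions -/

section Calculus

variable {m : ℕ} {M : Type*} [TopologicalSpace M] [ChartedSpace (EuclideanSpace ℝ (Fin m)) M]

theorem IsSmooth.mdifferentiableAt {f : M → ℝ} (hf : IsSmooth m f) (p : M) :
    MDifferentiableAt (𝓡 m) 𝓘(ℝ, ℝ) f p :=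
  hf.contMDiffAt.mdifferentiableAt (by simp)

theorem dif_congr {f g : M → ℝ} {p : M} (h : f =ᶠ[𝓝 p] g) : dif m f p = dif m g p := by
  ext v
  have h1 := h.mfderiv_eq (I := 𝓡 m) (I' := 𝓘(ℝ, ℝ))
  exact congrArg (fun L : EuclideanSpace ℝ (Fin m) →L[ℝ] ℝ ↦ L v) h1

theorem eventually_dif_eq {f g : M → ℝ} {p : M} (h : f =ᶠ[𝓝 p] g) :
    ∀ᶠ z in 𝓝 p, dif m f z = dif m g z := by
  filter_upwards [h.eventually_nhds] with z hz using dif_congr hz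

theorem dif_eq_zero_of_eventuallyEq {f : M → ℝ} {p : M} (h : ∀ᶠ z in 𝓝 p, f z = 0) :
    dif m f p = 0 := by
  rw [dif_congr (g := fun _ ↦ (0 : ℝ)) h]
  exact mvfderiv_const 0

theorem dif_add {f g : M → ℝ} {p : M} (hf : MDifferentiableAt (𝓡 m) 𝓘(ℝ, ℝ) f p)
    (hg : MDifferentiableAt (𝓡 m) 𝓘(ℝ, ℝ) g p) :
    dif m (fun z ↦ f z + g z) p = dif m f p + dif m g p :=
  mvfderiv_add hf hg

theorem dif_sub {f g : M → ℝ} {p : M} (hf : MDifferentiableAt (𝓡 m) 𝓘(ℝ, ℝ) f p)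
    (hg : MDifferentiableAt (𝓡 m) 𝓘(ℝ, ℝ) g p) :
    dif m (fun z ↦ f z - g z) p = dif m f p - dif m g p :=
  mvfderiv_sub hf hg

theorem dif_mul {f g : M → ℝ} {p : M} (hf : MDifferentiableAt (𝓡 m) 𝓘(ℝ, ℝ) f p)
    (hg : MDifferentiableAt (𝓡 m) 𝓘(ℝ, ℝ) g p) :
    dif m (fun z ↦ f z * g z) p = f p • dif m g p + g p • dif m f p :=
  mvfderiv_mul hf hg

variable {n : ℕ} {N : Type*} [TopologicalSpace N] [ChartedSpace (EuclideanSpace ℝ (Fin n)) N]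

theorem dif_comp {F : M → ℝ} {g : N → M} {x : N}
    (hF : MDifferentiableAt (𝓡 m) 𝓘(ℝ, ℝ) F (g x))
    (hg : MDifferentiableAt (𝓡 n) (𝓡 m) g x) (v : TangentSpace (𝓡 n) x) :
    dif n (fun z ↦ F (g z)) x v = dif m F (g x) (mfderiv (𝓡 n) (𝓡 m) g x v) :=
  mvfderiv_comp_apply x hF hg v

theorem dif_comp_model {F : EuclideanSpace ℝ (Fin m) → ℝ} {g : N → EuclideanSpace ℝ (Fin m)} {x : N}
    (hF : DifferentiableAt ℝ F (g x))
    (hg : MDifferentiableAt (𝓡 n) (𝓡 m) g x) (v : TangentSpace (𝓡 n) x) :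
    dif n (fun z ↦ F (g z)) x v = fderiv ℝ F (g x) (mfderiv (𝓡 n) (𝓡 m) g x v) := by
  have h := mfderiv_comp_apply (I' := 𝓡 m) (I'' := 𝓘(ℝ, ℝ)) x hF.mdifferentiableAt hg v
  rw [mfderiv_eq_fderiv] at h
  exact h

variable [IsManifold (𝓡 m) ∞ M]

/-- Germs of smooth functions extend to all of `M`, by a bump function. -/
theorem exists_isSmooth_eventuallyEq [T2Space M] {f : M → ℝ} {U : Set M} {p : M} (hU : IsOpen U)
    (hp : p ∈ U) (hf : ContMDiffOn (𝓡 m) 𝓘(ℝ, ℝ) ∞ f U) :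
    ∃ F : M → ℝ, IsSmooth m F ∧ F =ᶠ[𝓝 p] f := by
  obtain ⟨ψ, -, hψ⟩ := (SmoothBumpFunction.nhds_basis_tsupport (I := 𝓡 m) p).mem_iff.1
    (hU.mem_nhds hp)
  refine ⟨fun z ↦ ψ z * f z, ?_, ?_⟩
  · refine contMDiff_of_tsupport fun z hz ↦ ?_
    have hz' : z ∈ U := hψ (tsupport_smul_subset_left _ _ hz)
    exact ψ.contMDiffAt.mul (hf.contMDiffAt (hU.mem_nhds hz'))
  · filter_upwards [ψ.eventuallyEq_one] with z hz
    simp [hz]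

/-- The derivative of `f` along a smooth field `s` over a map `g : N → M` is smooth. -/
theorem contMDiffAt_dif_apply {g : N → M} {s : ∀ x : N, TangentSpace (𝓡 m) (g x)} {x₀ : N}
    (hs : ContMDiffAt (𝓡 n) (𝓡 m).tangent ∞ (fun x ↦ (⟨g x, s x⟩ : TangentBundle (𝓡 m) M)) x₀)
    {f : M → ℝ} (hf : IsSmooth m f) :
    ContMDiffAt (𝓡 n) 𝓘(ℝ, ℝ) ∞ (fun x ↦ dif m f (g x) (s x)) x₀ := by
  have h1 := ContMDiff.contMDiff_tangentMap hf (m := ∞) (by simp)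
  have h2 := (contMDiff_snd_tangentBundle_modelSpace (n := ∞) ℝ 𝓘(ℝ, ℝ))
  exact (h2.comp h1).contMDiffAt.comp x₀ hs

theorem IsVectorField.isSmooth_apply {X : VField m M} (hX : IsVectorField X) {f : M → ℝ}
    (hf : IsSmooth m f) : IsSmooth m (fun x ↦ dif m f x (X x)) :=
  fun x ↦ contMDiffAt_dif_apply (g := fun x ↦ x) (hX x) hf

theorem isSmooth_jacobiBracket {Λ : BivField m M} {E : VField m M} (hΛ : IsBivectorField Λ)
    (hE : IsVectorField E) {f g : M → ℝ} (hf : IsSmooth m f) (hg : IsSmooth m g) :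
    IsSmooth m (jacobiBracket Λ E f g) :=
  ((hΛ.smooth f g hf hg).add (hf.mul (hE.isSmooth_apply hg))).sub (hg.mul (hE.isSmooth_apply hf))

/-- Smoothness of a vector field can be tested on functions, since the components in a chart are
the derivatives of (germs of) the coordinate functions. -/
theorem isVectorField_of_forall_isSmooth_apply [T2Space M] {X : VField m M}
    (hX : ∀ f : M → ℝ, IsSmooth m f → IsSmooth m (fun x ↦ dif m f x (X x))) :
    IsVectorField X := by
  intro p
  have hp : p ∈ (trivializationAt (EuclideanSpace ℝ (Fin m)) (TangentSpace (𝓡 m)) p).baseSet :=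
    FiberBundle.mem_baseSet_trivializationAt' p
  refine (Bundle.Trivialization.contMDiffAt_section_iff
    (trivializationAt (EuclideanSpace ℝ (Fin m)) (TangentSpace (𝓡 m)) p) hp).2 ?_
  have key : ∀ i : Fin m, ContMDiffAt (𝓡 m) 𝓘(ℝ, ℝ) ∞
      (fun x ↦ ((trivializationAt (EuclideanSpace ℝ (Fin m)) (TangentSpace (𝓡 m)) p)
        ⟨x, X x⟩).2 i) p := by
    intro i
    have hc : ContMDiffOn (𝓡 m) (𝓡 m) ∞ (extChartAt (𝓡 m) p)
      (chartAt (EuclideanSpace ℝ (Fin m)) p).source := contMDiffOn_extChartAt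
    obtain ⟨F, hF, hFe⟩ := exists_isSmooth_eventuallyEq (m := m)
      (f := fun z ↦ extChartAt (𝓡 m) p z i)
      (chartAt (EuclideanSpace ℝ (Fin m)) p).open_source (mem_chart_source _ p)
      ((EuclideanSpace.proj (𝕜 := ℝ) i).contDiff.contMDiff.comp_contMDiffOn hc)
    refine (hX F hF p).congr_of_eventuallyEq ?_
    filter_upwards [eventually_dif_eq (m := m) hFe,
      (chartAt (EuclideanSpace ℝ (Fin m)) p).open_source.mem_nhds (mem_chart_source _ p)]
      with z hz hzs
    rw [hz]
    have h1 := TangentBundle.continuousLinearMapAt_trivializationAt (I := 𝓡 m) hzs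
    have h2 := dif_comp_model (m := m) (F := fun v ↦ v i) (g := extChartAt (𝓡 m) p) (x := z)
      (EuclideanSpace.proj (𝕜 := ℝ) i).differentiableAt
      (mdifferentiableAt_extChartAt hzs) (X z)
    refine Eq.trans ?_ h2.symm
    have h3 : fderiv ℝ (fun v : EuclideanSpace ℝ (Fin m) ↦ v i) (extChartAt (𝓡 m) p z)
      = EuclideanSpace.proj i := (EuclideanSpace.proj (𝕜 := ℝ) i).fderiv
    rw [h3]
    have h4 := congrArg
      (fun L : EuclideanSpace ℝ (Fin m) →L[ℝ] EuclideanSpace ℝ (Fin m) ↦ L (X z) i) h1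
    refine Eq.trans ?_ h4
    simp only
    erw [Bundle.Trivialization.continuousLinearMapAt_apply, Bundle.Trivialization.linearMapAt_apply]
    rw [if_pos]
    simpa using hzs
  have : ContMDiffAt (𝓡 m) 𝓘(ℝ, Fin m → ℝ) ∞ (fun x ↦ WithLp.ofLp
    ((trivializationAt (EuclideanSpace ℝ (Fin m)) (TangentSpace (𝓡 m)) p)
        ⟨x, X x⟩).2) p := contMDiffAt_pi_space.2 key
  exact (PiLp.continuousLinearEquiv 2 ℝ
    (fun _ : Fin m ↦ ℝ)).symm.contDiff.contMDiff.contMDiffAt.comp p this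

end Calculus

/-! ### Charts and vector fields with constant components -/

section Charts

variable {m : ℕ} {M : Type*} [TopologicalSpace M] [ChartedSpace (EuclideanSpace ℝ (Fin m)) M]
  {φ : OpenPartialHomeomorph M (EuclideanSpace ℝ (Fin m))}

theorem chart_mdifferentiable (hφ : φ ∈ IsManifold.maximalAtlas (𝓡 m) ∞ M) :
    φ.MDifferentiable (𝓡 m) (𝓡 m) :=
  ⟨(contMDiffOn_of_mem_maximalAtlas hφ).mdifferentiableOn (by simp),
    (contMDiffOn_symm_of_mem_maximalAtlas hφ).mdifferentiableOn (by simp)⟩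

theorem dif_comp_chart (hφ : φ ∈ IsManifold.maximalAtlas (𝓡 m) ∞ M) {z : M} (hz : z ∈ φ.source)
    {F : EuclideanSpace ℝ (Fin m) → ℝ} (hF : DifferentiableAt ℝ F (φ z))
    (v : TangentSpace (𝓡 m) z) :
    dif m (fun z ↦ F (φ z)) z v = fderiv ℝ F (φ z) (mvfderiv (𝓡 m) φ z v) :=
  dif_comp_model hF ((chart_mdifferentiable hφ).mdifferentiableAt hz) v

theorem dif_chart_apply (hφ : φ ∈ IsManifold.maximalAtlas (𝓡 m) ∞ M) {z : M} (hz : z ∈ φ.source)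
    (u : Fin m) (v : TangentSpace (𝓡 m) z) :
    dif m (fun z ↦ φ z u) z v = mvfderiv (𝓡 m) φ z v u := by
  rw [dif_comp_chart hφ hz (F := fun y ↦ y u) (EuclideanSpace.proj (𝕜 := ℝ) u).differentiableAt]
  have : fderiv ℝ (fun y : EuclideanSpace ℝ (Fin m) ↦ y u) (φ z) = EuclideanSpace.proj u :=
    (EuclideanSpace.proj (𝕜 := ℝ) u).fderiv
  rw [this]
  rfl

theorem mvfderiv_chart_bijective (hφ : φ ∈ IsManifold.maximalAtlas (𝓡 m) ∞ M) {z : M}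
    (hz : z ∈ φ.source) : Function.Bijective (mvfderiv (𝓡 m) φ z) :=
  (chart_mdifferentiable hφ).mfderiv_bijective hz

theorem isInvertible_mfderiv_chart (hφ : φ ∈ IsManifold.maximalAtlas (𝓡 m) ∞ M) {z : M}
    (hz : z ∈ φ.source) : (mfderiv (𝓡 m) (𝓡 m) φ z).IsInvertible :=
  ⟨(chart_mdifferentiable hφ).mfderiv hz, rfl⟩

/-- The vector field on the domain of `φ` whose components in the coordinates `φ` are the
constants `c`. -/
def constField (φ : OpenPartialHomeomorph M (EuclideanSpace ℝ (Fin m)))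
    (c : EuclideanSpace ℝ (Fin m)) : VField m M :=
  VectorField.mpullback (𝓡 m) (𝓡 m) φ fun _ ↦ c

theorem mvfderiv_constField (hφ : φ ∈ IsManifold.maximalAtlas (𝓡 m) ∞ M) {z : M}
    (hz : z ∈ φ.source) (c : EuclideanSpace ℝ (Fin m)) :
    mvfderiv (𝓡 m) φ z (constField φ c z) = c := by
  have h := (isInvertible_mfderiv_chart hφ hz).self_apply_inverse (y := c)
  exact h

theorem dif_chart_constField (hφ : φ ∈ IsManifold.maximalAtlas (𝓡 m) ∞ M) {z : M}
    (hz : z ∈ φ.source) (c : EuclideanSpace ℝ (Fin m)) (u : Fin m) :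
    dif m (fun z ↦ φ z u) z (constField φ c z) = c u := by
  rw [dif_chart_apply hφ hz, mvfderiv_constField hφ hz]

theorem contMDiffOn_chart_apply (hφ : φ ∈ IsManifold.maximalAtlas (𝓡 m) ∞ M) (u : Fin m) :
    ContMDiffOn (𝓡 m) 𝓘(ℝ, ℝ) ∞ (fun z ↦ φ z u) φ.source :=
  (EuclideanSpace.proj (𝕜 := ℝ) u).contDiff.contMDiff.comp_contMDiffOn
    (contMDiffOn_of_mem_maximalAtlas hφ)

variable [IsManifold (𝓡 m) ∞ M]

theorem contMDiffOn_constField (hφ : φ ∈ IsManifold.maximalAtlas (𝓡 m) ∞ M)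
    (c : EuclideanSpace ℝ (Fin m)) :
    ContMDiffOn (𝓡 m) (𝓡 m).tangent ∞
      (fun z ↦ (⟨z, constField φ c z⟩ : TangentBundle (𝓡 m) M)) φ.source := by
  intro z hz
  refine ContMDiffAt.contMDiffWithinAt ?_
  refine ContMDiffAt.mpullback_vectorField_preimage (n := ∞) (m := ∞) ?_
    ((contMDiffOn_of_mem_maximalAtlas hφ).contMDiffAt (φ.open_source.mem_nhds hz))
    (isInvertible_mfderiv_chart hφ hz) (by simp)
  exact contMDiffAt_vectorSpace_iff_contDiffAt.2 contDiffAt_const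

theorem exists_isSmooth_eventuallyEq_chart [T2Space M]
    (hφ : φ ∈ IsManifold.maximalAtlas (𝓡 m) ∞ M) {p : M}
    (hp : p ∈ φ.source) (u : Fin m) :
    ∃ F : M → ℝ, IsSmooth m F ∧ F =ᶠ[𝓝 p] fun z ↦ φ z u :=
  exists_isSmooth_eventuallyEq φ.open_source hp (contMDiffOn_chart_apply hφ u)

/-- `[∂, E]^u = ∂(E^u)` for a vector field `∂` with constant components in the coordinates `φ`. -/
theorem dif_chart_mlieBracket (hφ : φ ∈ IsManifold.maximalAtlas (𝓡 m) ∞ M) {p : M}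
    (hp : p ∈ φ.source) {c : EuclideanSpace ℝ (Fin m)} {X E : VField m M}
    (hX : ∀ᶠ z in 𝓝 p, X z = constField φ c z) (hE : IsVectorField E) (u : Fin m) :
    dif m (fun z ↦ φ z u) p (VectorField.mlieBracket (𝓡 m) X E p)
      = dif m (fun z ↦ dif m (fun q ↦ φ q u) z (E z)) p (X p) := by
  obtain ⟨y, hy, rfl⟩ : ∃ y ∈ φ.target, φ.symm y = p := ⟨φ p, φ.map_source hp, φ.left_inv hp⟩
  have hφs : φ.symm.MDifferentiable (𝓡 m) (𝓡 m) := (chart_mdifferentiable hφ).symm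
  -- the derivatives of `φ` and of its inverse are inverse to each other
  have hinv : ∀ y ∈ φ.target, ∀ v : TangentSpace (𝓡 m) (φ.symm y),
      (mfderiv (𝓡 m) (𝓡 m) φ.symm y).inverse v = mvfderiv (𝓡 m) φ (φ.symm y) v := by
    intro y hy v
    have h1 := (chart_mdifferentiable hφ).symm_comp_deriv (φ.map_target hy)
    rw [φ.right_inv hy] at h1
    have h2 : (mfderiv (𝓡 m) (𝓡 m) φ.symm y).IsInvertible := ⟨hφs.mfderiv hy, rfl⟩
    have h3 := congrArg (fun L ↦ (mfderiv (𝓡 m) (𝓡 m) φ.symm y).inverse (L v)) h1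
    refine Eq.trans h3.symm ?_
    exact h2.inverse_apply_self _
  have hsymm : ContMDiffAt (𝓡 m) (𝓡 m) ∞ φ.symm y :=
    (contMDiffOn_symm_of_mem_maximalAtlas hφ).contMDiffAt (φ.open_target.mem_nhds hy)
  set Y : EuclideanSpace ℝ (Fin m) → EuclideanSpace ℝ (Fin m) :=
    VectorField.mpullback (𝓡 m) (𝓡 m) φ.symm E with hYdef
  have hYd : DifferentiableAt ℝ Y y := by
    refine ContDiffAt.differentiableAt (n := ∞) (contMDiffAt_vectorSpace_iff_contDiffAt.1 ?_)
      (by simp)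
    exact ContMDiffAt.mpullback_vectorField_preimage (n := ∞) (m := ∞) (hE _) hsymm
      ⟨hφs.mfderiv hy, rfl⟩ (by simp)
  have hV : VectorField.mpullback (𝓡 m) (𝓡 m) φ.symm X =ᶠ[𝓝 y]
      (fun _ ↦ c : VField m (EuclideanSpace ℝ (Fin m))) := by
    filter_upwards [φ.open_target.mem_nhds hy, hsymm.continuousAt.eventually hX] with y' hy' h
    rw [VectorField.mpullback_apply, hinv y' hy', h]
    exact mvfderiv_constField hφ (φ.map_target hy') c
  have hXd : MDifferentiableAt (𝓡 m) (𝓡 m).tangent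
      (fun z ↦ (⟨z, X z⟩ : TangentBundle (𝓡 m) M)) (φ.symm y) := by
    have h1 := ((contMDiffOn_constField hφ c).contMDiffAt
      (φ.open_source.mem_nhds (φ.map_target hy))).mdifferentiableAt (by simp)
    refine h1.congr_of_eventuallyEq ?_
    filter_upwards [hX] with z hz
    rw [hz]
  have htwo : minSmoothness ℝ 2 ≤ (∞ : WithTop ℕ∞) := by
    rw [minSmoothness_of_isRCLikeNormedField]
    exact WithTop.coe_le_coe.2 le_top
  have : IsManifold (𝓡 m) (minSmoothness ℝ 2) M := IsManifold.of_le htwo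
  have hbr := VectorField.mpullback_mlieBracket (n := ∞) hXd
    ((hE _).mdifferentiableAt (by simp)) hsymm htwo
  rw [hV.mlieBracket_vectorField_eq (W := VectorField.mpullback (𝓡 m) (𝓡 m) φ.symm E)
    Filter.EventuallyEq.rfl, VectorField.mpullback_apply, hinv y hy] at hbr
  have hlie : VectorField.mlieBracket (𝓡 m) (fun _ ↦ c : VField m (EuclideanSpace ℝ (Fin m)))
      (VectorField.mpullback (𝓡 m) (𝓡 m) φ.symm E) y = fderiv ℝ Y y c := by
    refine (congrFun VectorField.mlieBracketWithin_univ.symm y).trans ?_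
    refine (congrFun VectorField.mlieBracketWithin_eq_lieBracketWithin y).trans ?_
    refine (congrFun VectorField.lieBracketWithin_univ y).trans ?_
    have h0 : fderiv ℝ (fun _ : EuclideanSpace ℝ (Fin m) ↦ c) y = 0 := fderiv_const_apply c
    change fderiv ℝ Y y c - fderiv ℝ (fun _ : EuclideanSpace ℝ (Fin m) ↦ c) y (Y y) = _
    rw [h0]
    simp
  rw [hlie] at hbr
  have hYu : DifferentiableAt ℝ (fun y ↦ Y y u) y :=
    (EuclideanSpace.proj (𝕜 := ℝ) u).differentiableAt.comp y hYd
  have hYu' : fderiv ℝ (fun y ↦ Y y u) y c = fderiv ℝ Y y c u := by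
    have := ((EuclideanSpace.proj (𝕜 := ℝ) u).hasFDerivAt.comp y hYd.hasFDerivAt).fderiv
    exact congrArg (fun L ↦ L c) this
  have hEY : (fun z ↦ dif m (fun q ↦ φ q u) z (E z)) =ᶠ[𝓝 (φ.symm y)] fun z ↦ Y (φ z) u := by
    filter_upwards [φ.open_source.mem_nhds hp] with z hz
    rw [dif_chart_apply hφ hz, hYdef, VectorField.mpullback_apply, hinv _ (φ.map_source hz)]
    rw [φ.left_inv hz]
  rw [dif_chart_apply hφ hp, hbr, dif_congr hEY,
    dif_comp_chart hφ hp (F := fun y ↦ Y y u) (by rwa [φ.right_inv hy]), hX.self_of_nhds,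
    mvfderiv_constField hφ hp, φ.right_inv hy, hYu']

end Charts

/-! ### Adapted charts -/

section Adapted

variable {n m : ℕ}
  {N : Type*} [TopologicalSpace N] [ChartedSpace (EuclideanSpace ℝ (Fin n)) N]
  {M : Type*} [TopologicalSpace M] [ChartedSpace (EuclideanSpace ℝ (Fin m)) M] {ι : N → M}

theorem mdifferentiableAt_of_isSmoothEmbedding
    (hι : Manifold.IsSmoothEmbedding (𝓡 n) (𝓡 m) ∞ ι) (x : N) :
    MDifferentiableAt (𝓡 n) (𝓡 m) ι x :=
  hι.contMDiff.contMDiffAt.mdifferentiableAt (by simp)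

variable [IsManifold (𝓡 m) ∞ M]

theorem Normalization.IsAdaptedChart.dif_chart_mfderiv {ν : Normalization n m ι}
    {φ : OpenPartialHomeomorph M (EuclideanSpace ℝ (Fin m))} {S : Set (Fin m)}
    (hφ : ν.IsAdaptedChart φ S) (hι : Manifold.IsSmoothEmbedding (𝓡 n) (𝓡 m) ∞ ι) {x : N}
    (hx : ι x ∈ φ.source) {a : Fin m} (ha : a ∉ S) (v : TangentSpace (𝓡 n) x) :
    dif m (fun z ↦ φ z a) (ι x) (mfderiv (𝓡 n) (𝓡 m) ι x v) = 0 := by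
  rw [← dif_comp (F := fun z ↦ φ z a) (((contMDiffOn_chart_apply hφ.mem_maximalAtlas a).contMDiffAt
    (φ.open_source.mem_nhds hx)).mdifferentiableAt (by simp))
    (mdifferentiableAt_of_isSmoothEmbedding hι x), dif_eq_zero_of_eventuallyEq]
  · rfl
  · filter_upwards [hι.isEmbedding.continuous.continuousAt.preimage_mem_nhds
      (φ.open_source.mem_nhds hx)] with z hz
    exact (hφ.mem_range_iff (ι z) hz).1 ⟨z, rfl⟩ a ha

variable [IsManifold (𝓡 n) ∞ N]

theorem Normalization.pT_mfderiv (hι : Manifold.IsSmoothEmbedding (𝓡 n) (𝓡 m) ∞ ι)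
    (ν : Normalization n m ι) (x : N) (v : TangentSpace (𝓡 n) x) :
    ν.pT hι x (mfderiv (𝓡 n) (𝓡 m) ι x v) = v :=
  LinearMap.linearProjOfIsCompl_apply_left _ _ (mfderiv_injective hι x) (ν.isCompl x) v

theorem Normalization.pT_of_mem_fiber (hι : Manifold.IsSmoothEmbedding (𝓡 n) (𝓡 m) ∞ ι)
    (ν : Normalization n m ι) (x : N) {w : TangentSpace (𝓡 m) (ι x)} (hw : w ∈ ν.fiber x) :
    ν.pT hι x w = 0 := by
  exact LinearMap.linearProjOfIsCompl_apply_right' _ _ (mfderiv_injective hι x) (ν.isCompl x) w hw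

theorem Normalization.sub_pT_mem_fiber (hι : Manifold.IsSmoothEmbedding (𝓡 n) (𝓡 m) ∞ ι)
    (ν : Normalization n m ι) (x : N) (w : TangentSpace (𝓡 m) (ι x)) :
    w - mfderiv (𝓡 n) (𝓡 m) ι x (ν.pT hι x w) ∈ ν.fiber x := by
  obtain ⟨a, ⟨v, rfl⟩, b, hb, rfl⟩ := Submodule.mem_sup.1
    ((ν.isCompl x).codisjoint.eq_top.symm ▸ Submodule.mem_top (x := w))
  have h : ν.pT hι x (mfderiv (𝓡 n) (𝓡 m) ι x v + b) = v := by
    rw [map_add, ν.pT_mfderiv hι, ν.pT_of_mem_fiber hι x hb, add_zero]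
  change mfderiv (𝓡 n) (𝓡 m) ι x v + b
    - mfderiv (𝓡 n) (𝓡 m) ι x (ν.pT hι x (mfderiv (𝓡 n) (𝓡 m) ι x v + b)) ∈ ν.fiber x
  rwa [h, add_sub_cancel_left]

theorem Normalization.inAnn_comp_pT (hι : Manifold.IsSmoothEmbedding (𝓡 n) (𝓡 m) ∞ ι)
    (ν : Normalization n m ι) (x : N) (α : Covector n x) : ν.InAnn x (α.comp (ν.pT hι x)) := by
  intro w hw
  simp [ν.pT_of_mem_fiber hι x hw]

/-- Along `N`, the differential of an extension of `f` that annihilates `νN` is `df ∘ p_T`. -/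
theorem Normalization.dif_comp_pT (hι : Manifold.IsSmoothEmbedding (𝓡 n) (𝓡 m) ∞ ι)
    (ν : Normalization n m ι) {x : N} {f : N → ℝ} {F : M → ℝ} (hF : IsSmooth m F)
    (hFf : ∀ᶠ z in 𝓝 x, F (ι z) = f z) (hFν : ν.InAnn x (dif m F (ι x))) :
    (dif n f x).comp (ν.pT hι x) = dif m F (ι x) := by
  ext w
  have h1 : dif n f x = dif n (fun z ↦ F (ι z)) x := dif_congr (hFf.mono fun z hz ↦ hz.symm)
  have h2 := hFν _ (ν.sub_pT_mem_fiber hι x w)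
  rw [map_sub, sub_eq_zero] at h2
  rw [h2, ContinuousLinearMap.comp_apply, h1, dif_comp (hF.mdifferentiableAt _)
    (mdifferentiableAt_of_isSmoothEmbedding hι x)]

/-- In an adapted chart, `νN` is the common kernel of the `dy^u`. -/
theorem Normalization.IsAdaptedChart.mem_fiber_iff {ν : Normalization n m ι}
    {φ : OpenPartialHomeomorph M (EuclideanSpace ℝ (Fin m))} {S : Set (Fin m)}
    (hφ : ν.IsAdaptedChart φ S) (hι : Manifold.IsSmoothEmbedding (𝓡 n) (𝓡 m) ∞ ι) {x : N}
    (hx : ι x ∈ φ.source) (w : TangentSpace (𝓡 m) (ι x)) :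
    w ∈ ν.fiber x ↔ ∀ u ∈ S, mvfderiv (𝓡 m) φ (ι x) w u = 0 := by
  constructor
  · intro hw u hu
    rw [← dif_chart_apply hφ.mem_maximalAtlas hx]
    exact hφ.normal x hx u hu w hw
  · intro hw
    have hn := ν.sub_pT_mem_fiber hι x w
    set t := mfderiv (𝓡 n) (𝓡 m) ι x (ν.pT hι x w) with ht
    have h0 : mvfderiv (𝓡 m) φ (ι x) t = 0 := by
      ext u
      by_cases hu : u ∈ S
      · have h1 := hφ.normal x hx u hu _ hn
        rw [map_sub, sub_eq_zero, dif_chart_apply hφ.mem_maximalAtlas hx, hw u hu,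
          dif_chart_apply hφ.mem_maximalAtlas hx] at h1
        exact h1.symm
      · rw [← dif_chart_apply hφ.mem_maximalAtlas hx]
        exact hφ.dif_chart_mfderiv hι hx hu _
    have h2 : t = 0 :=
      (mvfderiv_chart_bijective hφ.mem_maximalAtlas hx).1 (h0.trans (map_zero _).symm)
    rwa [h2, sub_zero] at hn

/-- The coordinate fields transverse to `N` extend, from a neighbourhood of a given point, to
global vector fields normal to `N`. -/
theorem Normalization.IsAdaptedChart.exists_isNormalField [T2Space M] {ν : Normalization n m ι}
    {φ : OpenPartialHomeomorph M (EuclideanSpace ℝ (Fin m))} {S : Set (Fin m)}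
    (hφ : ν.IsAdaptedChart φ S) (hι : Manifold.IsSmoothEmbedding (𝓡 n) (𝓡 m) ∞ ι) {p : M}
    (hp : p ∈ φ.source) {c : EuclideanSpace ℝ (Fin m)} (hc : ∀ u ∈ S, c u = 0) :
    ∃ X : VField m M, ν.IsNormalField X ∧ ∀ᶠ z in 𝓝 p, X z = constField φ c z := by
  obtain ⟨ψ, -, hψ⟩ := (SmoothBumpFunction.nhds_basis_tsupport (I := 𝓡 m) p).mem_iff.1
    (φ.open_source.mem_nhds hp)
  refine ⟨(ψ : M → ℝ) • constField φ c, ⟨?_, fun x ↦ ?_⟩, ?_⟩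
  · exact ψ.contMDiff.contMDiffOn.smul_section_of_tsupport φ.open_source hψ
      (contMDiffOn_constField hφ.mem_maximalAtlas c)
  · by_cases hx : ι x ∈ φ.source
    · refine (ν.fiber x).smul_mem _ ?_
      rw [hφ.mem_fiber_iff hι hx, mvfderiv_constField hφ.mem_maximalAtlas hx]
      exact hc
    · have h0 : ψ (ι x) = 0 := image_eq_zero_of_notMem_tsupport fun h ↦ hx (hψ h)
      have : ((ψ : M → ℝ) • constField φ c) (ι x) = 0 := by
        simp [h0]
      rw [this]
      exact (ν.fiber x).zero_mem
  · filter_upwards [ψ.eventuallyEq_one] with z hz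
    simp [hz]

/-- If `Λ` is quasi-soldered, then `∂Λ^{uv}/∂x^a = 0` along `N` in every adapted chart. -/
theorem Normalization.QuasiSolderedBivector.inAnn_dif_coord [T2Space M] {ν : Normalization n m ι}
    {Λ : BivField m M} (hΛ : ν.QuasiSolderedBivector Λ)
    {φ : OpenPartialHomeomorph M (EuclideanSpace ℝ (Fin m))} {S : Set (Fin m)}
    (hφ : ν.IsAdaptedChart φ S) (hι : Manifold.IsSmoothEmbedding (𝓡 n) (𝓡 m) ∞ ι) {x : N}
    (hx : ι x ∈ φ.source) {u v : Fin m} (hu : u ∈ S) (hv : v ∈ S) :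
    ν.InAnn x
      (dif m (fun z ↦ Λ z (dif m (fun p ↦ φ p u) z) (dif m (fun p ↦ φ p v) z)) (ι x)) := by
  intro w hw
  have hat := hφ.mem_maximalAtlas
  have hc := (hφ.mem_fiber_iff hι hx w).1 hw
  obtain ⟨X, hX, hXc⟩ := hφ.exists_isNormalField hι hx hc
  have hXw : X (ι x) = w := by
    apply (mvfderiv_chart_bijective hat hx).1
    rw [hXc.self_of_nhds, mvfderiv_constField hat hx]
  obtain ⟨f, hf, hfe⟩ := exists_isSmooth_eventuallyEq_chart hat hx u
  obtain ⟨g, hg, hge⟩ := exists_isSmooth_eventuallyEq_chart hat hx v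
  -- the field `X` has constant components, so it annihilates `y^u` and `y^v` near `ι x`
  have hzero : ∀ {f : M → ℝ} {u : Fin m}, u ∈ S → f =ᶠ[𝓝 (ι x)] (fun z ↦ φ z u) →
      dif m (fun z ↦ dif m f z (X z)) (ι x) = 0 := by
    intro f u hu hfe
    apply dif_eq_zero_of_eventuallyEq
    filter_upwards [hXc, eventually_dif_eq (m := m) hfe, φ.open_source.mem_nhds hx] with z h1 h2 h3
    rw [h1, h2, dif_chart_constField hat h3, hc u hu]
  have h := hΛ X hX x f g hf hg ((dif_congr (m := m) hfe).symm ▸ hφ.normal x hx u hu)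
    ((dif_congr (m := m) hge).symm ▸ hφ.normal x hx v hv)
  rw [lieDerivBivector, hzero hu hfe, hzero hv hge, map_zero, map_zero, LinearMap.zero_apply,
    sub_zero, sub_zero, hXw] at h
  rw [← h]
  refine congrArg (fun L : Covector m (ι x) ↦ L w) (dif_congr ?_)
  filter_upwards [eventually_dif_eq (m := m) hfe, eventually_dif_eq (m := m) hge] with z h1 h2
  rw [h1, h2]

/-- If `E` is quasi-soldered, then `∂E^u/∂x^a = 0` along `N` in every adapted chart. -/
theorem Normalization.QuasiSolderedVector.inAnn_dif_coord [T2Space M] {ν : Normalization n m ι}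
    {E : VField m M} (hE : ν.QuasiSolderedVector E) (hEs : IsVectorField E)
    {φ : OpenPartialHomeomorph M (EuclideanSpace ℝ (Fin m))} {S : Set (Fin m)}
    (hφ : ν.IsAdaptedChart φ S) (hι : Manifold.IsSmoothEmbedding (𝓡 n) (𝓡 m) ∞ ι) {x : N}
    (hx : ι x ∈ φ.source) {u : Fin m} (hu : u ∈ S) :
    ν.InAnn x (dif m (fun z ↦ dif m (fun p ↦ φ p u) z (E z)) (ι x)) := by
  intro w hw
  have hat := hφ.mem_maximalAtlas
  have hc := (hφ.mem_fiber_iff hι hx w).1 hw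
  obtain ⟨X, hX, hXc⟩ := hφ.exists_isNormalField hι hx hc
  have hXw : X (ι x) = w := by
    apply (mvfderiv_chart_bijective hat hx).1
    rw [hXc.self_of_nhds, mvfderiv_constField hat hx]
  have h := hE X hX x _ (hφ.normal x hx u hu)
  rwa [dif_chart_mlieBracket hat hx hXc hEs, hXw] at h

end Adapted

/-! ### Extensions depending only on the coordinates along the submanifold -/

section Extension

variable {n m : ℕ}
  {N : Type*} [TopologicalSpace N] [ChartedSpace (EuclideanSpace ℝ (Fin n)) N]
  {M : Type*} [TopologicalSpace M] [ChartedSpace (EuclideanSpace ℝ (Fin m)) M] {ι : N → M}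

/-- The local normal form of an immersion: in suitable charts `d` of `N` and `c` of `M` it is a
linear map `j` with a linear left inverse `q`. -/
theorem exists_charts_linear (hι : Manifold.IsSmoothEmbedding (𝓡 n) (𝓡 m) ∞ ι) (x : N) :
    ∃ (d : OpenPartialHomeomorph N (EuclideanSpace ℝ (Fin n)))
      (c : OpenPartialHomeomorph M (EuclideanSpace ℝ (Fin m)))
      (j : EuclideanSpace ℝ (Fin n) →L[ℝ] EuclideanSpace ℝ (Fin m))
      (q : EuclideanSpace ℝ (Fin m) →L[ℝ] EuclideanSpace ℝ (Fin n)),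
      d ∈ IsManifold.maximalAtlas (𝓡 n) ∞ N ∧ c ∈ IsManifold.maximalAtlas (𝓡 m) ∞ M ∧
      x ∈ d.source ∧ (∀ z ∈ d.source, ι z ∈ c.source ∧ c (ι z) = j (d z)) ∧
      ∀ v, q (j v) = v := by
  have h := hι.isImmersion.isImmersionAt x
  refine ⟨h.domChart, h.codChart,
    h.equiv.toContinuousLinearMap ∘L ContinuousLinearMap.inl ℝ _ _,
    ContinuousLinearMap.fst ℝ _ _ ∘L h.equiv.symm.toContinuousLinearMap,
    h.domChart_mem_maximalAtlas, h.codChart_mem_maximalAtlas, h.mem_domChart_source,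
    fun z hz ↦ ⟨h.source_subset_preimage_source hz, ?_⟩, fun v ↦ by simp⟩
  have hm : h.domChart z ∈ (h.domChart.extend (𝓡 n)).target := by
    simpa [OpenPartialHomeomorph.extend_target] using h.domChart.map_source hz
  have h1 := h.writtenInCharts hm
  simp only [Function.comp_apply, OpenPartialHomeomorph.extend_coe,
    OpenPartialHomeomorph.extend_coe_symm, modelWithCornersSelf_coe,
    modelWithCornersSelf_coe_symm, id, h.domChart.left_inv hz] at h1
  simp [h1]

/-- A smooth embedding has, near each point of its image, a smooth local left inverse. -/
theorem exists_local_left_inverse (hι : Manifold.IsSmoothEmbedding (𝓡 n) (𝓡 m) ∞ ι) (x : N) :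
    ∃ (r : M → N) (W : Set M), IsOpen W ∧ ι x ∈ W ∧ ContMDiffOn (𝓡 m) (𝓡 n) ∞ r W ∧
      ∀ᶠ z in 𝓝 x, r (ι z) = z := by
  obtain ⟨d, c, j, q, hd, hc, hx, hloc, hqj⟩ := exists_charts_linear hι x
  have hq : ContMDiffOn (𝓡 m) (𝓡 n) ∞ (fun z ↦ q (c z)) c.source :=
    q.contDiff.contMDiff.comp_contMDiffOn (contMDiffOn_of_mem_maximalAtlas hc)
  refine ⟨fun z ↦ d.symm (q (c z)), c.source ∩ (fun z ↦ q (c z)) ⁻¹' d.target,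
    hq.continuousOn.isOpen_inter_preimage c.open_source d.open_target,
    ⟨(hloc x hx).1, ?_⟩, ?_, ?_⟩
  · change q (c (ι x)) ∈ d.target
    rw [(hloc x hx).2, hqj]
    exact d.map_source hx
  · exact (contMDiffOn_symm_of_mem_maximalAtlas hd).comp
      (hq.mono Set.inter_subset_left) fun z hz ↦ hz.2
  · filter_upwards [d.open_source.mem_nhds hx] with z hz
    rw [(hloc z hz).2, hqj, d.left_inv hz]

open Classical in
/-- The projection of `ℝᵐ` that keeps the coordinates in `S` and sets the others to zero. -/
def sliceProj (S : Set (Fin m)) : EuclideanSpace ℝ (Fin m) →L[ℝ] EuclideanSpace ℝ (Fin m) :=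
  (PiLp.continuousLinearEquiv 2 ℝ (fun _ : Fin m ↦ ℝ)).symm.toContinuousLinearMap ∘L
    ContinuousLinearMap.pi fun u ↦ if u ∈ S then EuclideanSpace.proj u else 0

theorem sliceProj_of_mem {S : Set (Fin m)} {u : Fin m} (hu : u ∈ S)
    (y : EuclideanSpace ℝ (Fin m)) : sliceProj S y u = y u := by
  simp [sliceProj, hu]

theorem sliceProj_of_notMem {S : Set (Fin m)} {u : Fin m} (hu : u ∉ S)
    (y : EuclideanSpace ℝ (Fin m)) : sliceProj S y u = 0 := by
  simp [sliceProj, hu]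

theorem sliceProj_eq_self {S : Set (Fin m)} {y : EuclideanSpace ℝ (Fin m)}
    (hy : ∀ a ∉ S, y a = 0) : sliceProj S y = y := by
  ext u
  by_cases hu : u ∈ S
  · exact sliceProj_of_mem hu y
  · rw [sliceProj_of_notMem hu, hy u hu]

theorem sliceProj_eq_zero {S : Set (Fin m)} {y : EuclideanSpace ℝ (Fin m)}
    (hy : ∀ u ∈ S, y u = 0) : sliceProj S y = 0 := by
  ext u
  by_cases hu : u ∈ S
  · rw [sliceProj_of_mem hu, hy u hu]; rfl
  · rw [sliceProj_of_notMem hu]; rfl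

variable [IsManifold (𝓡 m) ∞ M]

/-- `k` is differentiable at `x ∈ N` and its differential there annihilates `νN`. -/
def Normalization.KillsNormal (ν : Normalization n m ι) (x : N) (k : M → ℝ) : Prop :=
  MDifferentiableAt (𝓡 m) 𝓘(ℝ, ℝ) k (ι x) ∧ ν.InAnn x (dif m k (ι x))

namespace Normalization.KillsNormal

variable {ν : Normalization n m ι} {x : N} {k l : M → ℝ}

theorem congr (hk : ν.KillsNormal x k) (h : l =ᶠ[𝓝 (ι x)] k) : ν.KillsNormal x l :=
  ⟨hk.1.congr_of_eventuallyEq h, (dif_congr (m := m) h).symm ▸ hk.2⟩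

theorem zero : ν.KillsNormal x (fun _ ↦ 0) :=
  ⟨mdifferentiableAt_const, fun w _ ↦ by
    rw [dif_eq_zero_of_eventuallyEq (Filter.Eventually.of_forall fun _ ↦ rfl)]; rfl⟩

theorem add (hk : ν.KillsNormal x k) (hl : ν.KillsNormal x l) :
    ν.KillsNormal x (fun z ↦ k z + l z) :=
  ⟨hk.1.add hl.1, fun w hw ↦ by
    rw [dif_add hk.1 hl.1, add_apply, hk.2 w hw, hl.2 w hw, add_zero]⟩

theorem mul (hk : ν.KillsNormal x k) (hl : ν.KillsNormal x l) :
    ν.KillsNormal x (fun z ↦ k z * l z) :=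
  ⟨hk.1.mul hl.1, fun w hw ↦ by
    rw [dif_mul hk.1 hl.1]
    simp [hk.2 w hw, hl.2 w hw]⟩

theorem sum {α : Type*} (s : Finset α) {k : α → M → ℝ} (hk : ∀ i ∈ s, ν.KillsNormal x (k i)) :
    ν.KillsNormal x (fun z ↦ ∑ i ∈ s, k i z) := by
  classical
  induction s using Finset.induction_on with
  | empty => simpa using zero
  | insert i s hi ih =>
    simp only [Finset.sum_insert hi]
    exact (hk i (Finset.mem_insert_self i s)).add
      (ih fun j hj ↦ hk j (Finset.mem_insert_of_mem hj))

end Normalization.KillsNormal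

/-- `F` is a smooth function on `M` that extends `f` near `x₀ ∈ N` and that depends, near `ι x₀`,
only on the coordinates `y^u` of the adapted chart `φ`. The latter is recorded through the partial
derivatives `a u = ∂F/∂y^u`: `dF = ∑ a_u dy^u`, and the differentials of the `a u` at `x₀`
annihilate `νN`. -/
structure Normalization.IsAdaptedExtension (ν : Normalization n m ι)
    (φ : OpenPartialHomeomorph M (EuclideanSpace ℝ (Fin m))) (S : Set (Fin m)) (x₀ : N)
    (f : N → ℝ) (F : M → ℝ) (a : Fin m → M → ℝ) : Prop where
  isSmooth : IsSmooth m F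
  comp_eq : ∀ᶠ x in 𝓝 x₀, F (ι x) = f x
  coeff_eq_zero : ∀ u ∉ S, ∀ z, a u z = 0
  dif_eq : ∀ᶠ z in 𝓝 (ι x₀), dif m F z = ∑ u, a u z • dif m (fun p ↦ φ p u) z
  killsNormal : ∀ u, ν.KillsNormal x₀ (a u)

/-- In an adapted chart, `f` extends to the function `F = f ∘ φ⁻¹ ∘ P ∘ φ`, where `P` sets the
transverse coordinates to zero. As `f` lives on `N` only, it is composed with a local smooth
left inverse `r` of `ι`. -/
theorem Normalization.IsAdaptedChart.exists_isAdaptedExtension [T2Space M]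
    {ν : Normalization n m ι}
    {φ : OpenPartialHomeomorph M (EuclideanSpace ℝ (Fin m))} {S : Set (Fin m)}
    (hφ : ν.IsAdaptedChart φ S) (hι : Manifold.IsSmoothEmbedding (𝓡 n) (𝓡 m) ∞ ι) {x₀ : N}
    (hx₀ : ι x₀ ∈ φ.source) {f : N → ℝ} (hf : IsSmooth n f) :
    ∃ F a, ν.IsAdaptedExtension φ S x₀ f F a := by
  have hat := hφ.mem_maximalAtlas
  obtain ⟨r, W, hW, hxW, hr, hrι⟩ := exists_local_left_inverse hι x₀
  set P := sliceProj S with hP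
  set O : Set (EuclideanSpace ℝ (Fin m)) := φ.target ∩ φ.symm ⁻¹' W with hO
  have hOo : IsOpen O := φ.symm.isOpen_inter_preimage hW
  have hslice : ∀ x : N, ι x ∈ φ.source → P (φ (ι x)) = φ (ι x) := fun x hx ↦
    sliceProj_eq_self ((hφ.mem_range_iff (ι x) hx).1 ⟨x, rfl⟩)
  -- `f` in the coordinates `φ`, on the slice `φ(N)` and near it
  set G : EuclideanSpace ℝ (Fin m) → ℝ := fun y ↦ f (r (φ.symm y)) with hG
  have hGs : ContDiffOn ℝ ∞ G O := by
    refine ContMDiffOn.contDiffOn ?_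
    exact hf.comp_contMDiffOn (hr.comp ((contMDiffOn_symm_of_mem_maximalAtlas hat).mono
      Set.inter_subset_left) fun y hy ↦ hy.2)
  have hPc : ContMDiffOn (𝓡 m) (𝓡 m) ∞ (fun z ↦ P (φ z)) φ.source :=
    P.contDiff.contMDiff.comp_contMDiffOn (contMDiffOn_of_mem_maximalAtlas hat)
  set V : Set M := φ.source ∩ (fun z ↦ P (φ z)) ⁻¹' O with hV
  have hVo : IsOpen V := hPc.continuousOn.isOpen_inter_preimage φ.open_source hOo
  have hPO : ι x₀ ∈ V := by
    refine ⟨hx₀, ?_⟩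
    change P (φ (ι x₀)) ∈ O
    rw [hslice x₀ hx₀]
    exact ⟨φ.map_source hx₀, by rwa [Set.mem_preimage, φ.left_inv hx₀]⟩
  obtain ⟨F, hF, hFe⟩ := exists_isSmooth_eventuallyEq (m := m) (f := fun z ↦ G (P (φ z))) hVo hPO
    (hGs.contMDiffOn.comp (hPc.mono Set.inter_subset_left) fun z hz ↦ hz.2)
  have hιc := hι.isEmbedding.continuous.continuousAt (x := x₀)
  refine ⟨F, fun u z ↦ fderiv ℝ G (P (φ z)) (P (EuclideanSpace.single u 1)), hF, ?_, ?_, ?_, ?_⟩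
  · filter_upwards [hιc.eventually hFe, hιc.eventually (φ.open_source.mem_nhds hx₀), hrι]
      with x h1 h2 h3
    rw [h1, hslice x h2, hG]
    simp only
    rw [φ.left_inv h2, h3]
  · intro u hu z
    have h0 : P (EuclideanSpace.single u 1) = 0 := sliceProj_eq_zero fun v hv ↦ by
      have : v ≠ u := fun h ↦ hu (h ▸ hv)
      simp [this]
    simp only [h0, map_zero]
  · filter_upwards [eventually_dif_eq (m := m) hFe, hVo.mem_nhds hPO] with z hz hzV
    rw [hz]
    ext w
    have hGd : DifferentiableAt ℝ G (P (φ z)) :=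
      (hGs.contDiffAt (hOo.mem_nhds hzV.2)).differentiableAt (by simp)
    rw [dif_comp_chart hat hzV.1 (F := fun y ↦ G (P y)) (hGd.comp (φ z) P.differentiableAt)]
    have h1 : fderiv ℝ (fun y ↦ G (P y)) (φ z) = (fderiv ℝ G (P (φ z))).comp P :=
      (hGd.hasFDerivAt.comp (φ z) P.hasFDerivAt).fderiv
    rw [h1]
    set y := mvfderiv (𝓡 m) φ z w with hy
    have h2 : y = ∑ u, y u • EuclideanSpace.single u (1 : ℝ) := by
      ext v
      simp [Finset.sum_apply, Pi.single_apply]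
    rw [sum_apply]
    conv_lhs => rw [h2]
    rw [map_sum]
    refine Finset.sum_congr rfl fun u _ ↦ ?_
    rw [map_smul, smul_apply, dif_chart_apply hat hzV.1, smul_eq_mul,
      smul_eq_mul, mul_comm]
    rfl
  · intro u
    set e := P (EuclideanSpace.single u 1) with he
    have hB : ContDiffAt ℝ ∞ (fun y ↦ fderiv ℝ G y e) (P (φ (ι x₀))) := by
      have h1 : ContDiffAt ℝ ∞ (fderiv ℝ G) (P (φ (ι x₀))) :=
        (hGs.contDiffAt (hOo.mem_nhds hPO.2)).fderiv_right (by simp)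
      exact h1.clm_apply contDiffAt_const
    have hBd := hB.differentiableAt (by simp)
    have hBP : DifferentiableAt ℝ (fun y ↦ fderiv ℝ G (P y) e) (φ (ι x₀)) :=
      hBd.comp (f := P) (φ (ι x₀)) P.differentiableAt
    refine ⟨?_, fun w hw ↦ ?_⟩
    · exact hBP.mdifferentiableAt.comp (I' := 𝓡 m) (ι x₀)
        ((chart_mdifferentiable hat).mdifferentiableAt hx₀)
    · rw [dif_comp_chart hat hx₀ (F := fun y ↦ fderiv ℝ G (P y) e) hBP]
      have h1 : fderiv ℝ (fun y ↦ fderiv ℝ G (P y) e) (φ (ι x₀))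
          = (fderiv ℝ (fun y ↦ fderiv ℝ G y e) (P (φ (ι x₀)))).comp P :=
        (hBd.hasFDerivAt.comp (f := P) (φ (ι x₀)) P.hasFDerivAt).fderiv
      have h2 : P (mvfderiv (𝓡 m) φ (ι x₀) w) = 0 := by
        refine sliceProj_eq_zero fun u hu ↦ ?_
        rw [← dif_chart_apply hat hx₀]
        exact hφ.normal x₀ hx₀ u hu w hw
      rw [h1, ContinuousLinearMap.comp_apply, h2, map_zero]

namespace Normalization.IsAdaptedExtension

variable {ν : Normalization n m ι} {φ : OpenPartialHomeomorph M (EuclideanSpace ℝ (Fin m))}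
  {S : Set (Fin m)} {x₀ : N} {f g : N → ℝ} {F G : M → ℝ} {a b : Fin m → M → ℝ}

theorem eventually_inAnn (hF : ν.IsAdaptedExtension φ S x₀ f F a) (hφ : ν.IsAdaptedChart φ S)
    (hι : Continuous ι) (hx₀ : ι x₀ ∈ φ.source) :
    ∀ᶠ x in 𝓝 x₀, ν.InAnn x (dif m F (ι x)) := by
  filter_upwards [hι.continuousAt.eventually hF.dif_eq,
    hι.continuousAt.eventually (φ.open_source.mem_nhds hx₀)] with x h1 h2 w hw
  rw [h1, sum_apply]
  refine Finset.sum_eq_zero fun u _ ↦ ?_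
  by_cases hu : u ∈ S
  · rw [smul_apply, hφ.normal x h2 u hu w hw, smul_zero]
  · rw [hF.coeff_eq_zero u hu, zero_smul, zero_apply]

/-- If the normal derivatives of the `Λ^{uv}` vanish at `x₀`, then so do those of `Λ(dF, dG)` for
all functions `F`, `G` of the coordinates `y^u`. -/
theorem killsNormal_bivector [T2Space M] {Λ : BivField m M} (hΛ : IsBivectorField Λ)
    (hF : ν.IsAdaptedExtension φ S x₀ f F a) (hG : ν.IsAdaptedExtension φ S x₀ g G b)
    (hφ : ν.IsAdaptedChart φ S) (hx₀ : ι x₀ ∈ φ.source)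
    (h : ∀ u ∈ S, ∀ v ∈ S, ν.InAnn x₀
      (dif m (fun z ↦ Λ z (dif m (fun p ↦ φ p u) z) (dif m (fun p ↦ φ p v) z)) (ι x₀))) :
    ν.KillsNormal x₀ (fun z ↦ Λ z (dif m F z) (dif m G z)) := by
  have hk : ν.KillsNormal x₀ (fun z ↦ ∑ u, ∑ v, a u z * (b v z *
      Λ z (dif m (fun p ↦ φ p u) z) (dif m (fun p ↦ φ p v) z))) := by
    refine Normalization.KillsNormal.sum _ fun u _ ↦ Normalization.KillsNormal.sum _ fun v _ ↦ ?_
    by_cases hu : u ∈ S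
    · by_cases hv : v ∈ S
      · refine (hF.killsNormal u).mul ((hG.killsNormal v).mul ⟨?_, h u hu v hv⟩)
        obtain ⟨y, hy, hye⟩ := exists_isSmooth_eventuallyEq_chart hφ.mem_maximalAtlas hx₀ u
        obtain ⟨y', hy', hye'⟩ := exists_isSmooth_eventuallyEq_chart hφ.mem_maximalAtlas hx₀ v
        refine ((hΛ.smooth y y' hy hy').mdifferentiableAt (ι x₀)).congr_of_eventuallyEq ?_
        filter_upwards [eventually_dif_eq (m := m) hye, eventually_dif_eq (m := m) hye']
          with z h1 h2
        rw [h1, h2]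
      · simpa [hG.coeff_eq_zero v hv] using Normalization.KillsNormal.zero
    · simpa [hF.coeff_eq_zero u hu] using Normalization.KillsNormal.zero
  refine hk.congr ?_
  filter_upwards [hF.dif_eq, hG.dif_eq] with z h1 h2
  rw [h1, h2]
  simp only [map_sum, map_smul, LinearMap.sum_apply, LinearMap.smul_apply, smul_eq_mul,
    Finset.mul_sum]
  rw [Finset.sum_comm]
  exact Finset.sum_congr rfl fun u _ ↦ Finset.sum_congr rfl fun v _ ↦ by ring

/-- If the normal derivatives of the `E^u` vanish at `x₀`, then so do those of `dF(E)` for every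
function `F` of the coordinates `y^u`. -/
theorem killsNormal_vector [T2Space M] {E : VField m M} (hE : IsVectorField E)
    (hF : ν.IsAdaptedExtension φ S x₀ f F a) (hφ : ν.IsAdaptedChart φ S) (hx₀ : ι x₀ ∈ φ.source)
    (h : ∀ u ∈ S, ν.InAnn x₀ (dif m (fun z ↦ dif m (fun p ↦ φ p u) z (E z)) (ι x₀))) :
    ν.KillsNormal x₀ (fun z ↦ dif m F z (E z)) := by
  have hk : ν.KillsNormal x₀ (fun z ↦ ∑ u, a u z * dif m (fun p ↦ φ p u) z (E z)) := by
    refine Normalization.KillsNormal.sum _ fun u _ ↦ ?_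
    by_cases hu : u ∈ S
    · refine (hF.killsNormal u).mul ⟨?_, h u hu⟩
      obtain ⟨y, hy, hye⟩ := exists_isSmooth_eventuallyEq_chart hφ.mem_maximalAtlas hx₀ u
      refine ((hE.isSmooth_apply hy).mdifferentiableAt (ι x₀)).congr_of_eventuallyEq ?_
      filter_upwards [eventually_dif_eq (m := m) hye] with z h1
      rw [h1]
    · simpa [hF.coeff_eq_zero u hu] using Normalization.KillsNormal.zero
  refine hk.congr ?_
  filter_upwards [hF.dif_eq] with z h1
  rw [h1]
  simp

end Normalization.IsAdaptedExtension

end Extension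

/-! ### The induced bracket -/

section Induced

variable {n m : ℕ}
  {N : Type*} [TopologicalSpace N] [ChartedSpace (EuclideanSpace ℝ (Fin n)) N]
  {M : Type*} [TopologicalSpace M] [ChartedSpace (EuclideanSpace ℝ (Fin m)) M] {ι : N → M}

theorem IsBivectorField.swap {Λ : BivField m M} (hΛ : IsBivectorField Λ) {x : M}
    (α β : Covector m x) : Λ x α β = -Λ x β α := by
  have h := hΛ.alternating x (α + β)
  simp only [map_add, LinearMap.add_apply, hΛ.alternating, zero_add, add_zero] at h
  linarith

variable [IsManifold (𝓡 m) ∞ M]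

/-- `F` is a smooth function on `M` which extends `f` near `x₀ ∈ N` and whose differential
annihilates `νN` along `N` near `x₀`. -/
structure Normalization.IsNormalExtension (ν : Normalization n m ι) (x₀ : N) (f : N → ℝ)
    (F : M → ℝ) : Prop where
  isSmooth : IsSmooth m F
  comp_eq : ∀ᶠ x in 𝓝 x₀, F (ι x) = f x
  inAnn : ∀ᶠ x in 𝓝 x₀, ν.InAnn x (dif m F (ι x))

theorem Normalization.IsAdaptedExtension.isNormalExtension {ν : Normalization n m ι}
    {φ : OpenPartialHomeomorph M (EuclideanSpace ℝ (Fin m))} {S : Set (Fin m)} {x₀ : N}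
    {f : N → ℝ} {F : M → ℝ} {a : Fin m → M → ℝ} (hF : ν.IsAdaptedExtension φ S x₀ f F a)
    (hφ : ν.IsAdaptedChart φ S) (hι : Continuous ι) (hx₀ : ι x₀ ∈ φ.source) :
    ν.IsNormalExtension x₀ f F :=
  ⟨hF.isSmooth, hF.comp_eq, hF.eventually_inAnn hφ hι hx₀⟩

/-- The derivative of `{F, G}` in a direction of `νN`, when those of `F`, `G` and `Λ(dF, dG)`
vanish. -/
theorem Normalization.dif_jacobiBracket_of_mem_fiber {ν : Normalization n m ι} {x₀ : N}
    {Λ : BivField m M} {E : VField m M} (hE : IsVectorField E) {F G : M → ℝ}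
    (hF : IsSmooth m F) (hG : IsSmooth m G) (hFν : ν.InAnn x₀ (dif m F (ι x₀)))
    (hGν : ν.InAnn x₀ (dif m G (ι x₀)))
    (hΛ : ν.KillsNormal x₀ (fun z ↦ Λ z (dif m F z) (dif m G z)))
    {w : TangentSpace (𝓡 m) (ι x₀)} (hw : w ∈ ν.fiber x₀) :
    dif m (jacobiBracket Λ E F G) (ι x₀) w
      = F (ι x₀) * dif m (fun z ↦ dif m G z (E z)) (ι x₀) w
        - G (ι x₀) * dif m (fun z ↦ dif m F z (E z)) (ι x₀) w := by
  have hF' := hF.mdifferentiableAt (ι x₀)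
  have hG' := hG.mdifferentiableAt (ι x₀)
  have hEF := (hE.isSmooth_apply hF).mdifferentiableAt (ι x₀)
  have hEG := (hE.isSmooth_apply hG).mdifferentiableAt (ι x₀)
  change dif m (fun z ↦ (Λ z (dif m F z) (dif m G z) + F z * dif m G z (E z))
    - G z * dif m F z (E z)) (ι x₀) w = _
  have h1 : MDifferentiableAt (𝓡 m) 𝓘(ℝ, ℝ) (fun z ↦ F z * dif m G z (E z)) (ι x₀) := hF'.mul hEG
  have h2 : MDifferentiableAt (𝓡 m) 𝓘(ℝ, ℝ) (fun z ↦ G z * dif m F z (E z)) (ι x₀) := hG'.mul hEF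
  have h3 : MDifferentiableAt (𝓡 m) 𝓘(ℝ, ℝ)
      (fun z ↦ Λ z (dif m F z) (dif m G z) + F z * dif m G z (E z)) (ι x₀) := hΛ.1.add h1
  rw [dif_sub h3 h2, dif_add hΛ.1 h1, dif_mul hF' hEG, dif_mul hG' hEF]
  simp only [sub_apply, add_apply, smul_apply, smul_eq_mul, hΛ.2 w hw, hFν w hw, hGν w hw]
  ring

variable [IsManifold (𝓡 n) ∞ N]

theorem Normalization.inducedBivector_apply (hι : Manifold.IsSmoothEmbedding (𝓡 n) (𝓡 m) ∞ ι)
    (ν : Normalization n m ι) (Λ : BivField m M) (x : N) (α β : Covector n x) :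
    ν.inducedBivector hι Λ x α β
      = Λ (ι x) (α.comp (ν.pT hι x)) (β.comp (ν.pT hι x)) :=
  rfl

/-- For two normalizations to which `Λ` is algebraically compatible, `Λ(α ∘ p₁, ·)` is tangent to
`N`, and so it does not distinguish `β ∘ p₁` from `β ∘ p₂`; the same holds in the other slot. -/
theorem Normalization.inducedBivector_eq_of_compat
    (hι : Manifold.IsSmoothEmbedding (𝓡 n) (𝓡 m) ∞ ι) {Λ : BivField m M}
    (hΛ : IsBivectorField Λ) {ν₁ ν₂ : Normalization n m ι} (h₁ : ν₁.CompatBivector Λ)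
    (h₂ : ν₂.CompatBivector Λ) : ν₁.inducedBivector hι Λ = ν₂.inducedBivector hι Λ := by
  funext x
  refine LinearMap.ext fun α ↦ LinearMap.ext fun β ↦ ?_
  obtain ⟨v₁, hv₁⟩ := h₁ x _ (ν₁.inAnn_comp_pT hι x α)
  obtain ⟨v₂, hv₂⟩ := h₂ x _ (ν₂.inAnn_comp_pT hι x β)
  have e1 : Λ (ι x) (α.comp (ν₁.pT hι x)) (β.comp (ν₁.pT hι x))
      = Λ (ι x) (α.comp (ν₁.pT hι x)) (β.comp (ν₂.pT hι x)) := by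
    rw [hv₁, hv₁, ContinuousLinearMap.comp_apply, ContinuousLinearMap.comp_apply,
      ν₁.pT_mfderiv hι, ν₂.pT_mfderiv hι]
  have e2 : Λ (ι x) (β.comp (ν₂.pT hι x)) (α.comp (ν₁.pT hι x))
      = Λ (ι x) (β.comp (ν₂.pT hι x)) (α.comp (ν₂.pT hι x)) := by
    rw [hv₂, hv₂, ContinuousLinearMap.comp_apply, ContinuousLinearMap.comp_apply,
      ν₁.pT_mfderiv hι, ν₂.pT_mfderiv hι]
  rw [ν₁.inducedBivector_apply, ν₂.inducedBivector_apply, e1, hΛ.swap, e2, ← hΛ.swap]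

namespace Normalization.IsNormalExtension

variable {ν : Normalization n m ι} {x₀ : N} {f g : N → ℝ} {F G : M → ℝ}

theorem eventually_dif_comp_pT (hF : ν.IsNormalExtension x₀ f F)
    (hι : Manifold.IsSmoothEmbedding (𝓡 n) (𝓡 m) ∞ ι) :
    ∀ᶠ x in 𝓝 x₀, (dif n f x).comp (ν.pT hι x) = dif m F (ι x) := by
  filter_upwards [hF.comp_eq.eventually_nhds, hF.inAnn] with x h1 h2
    using ν.dif_comp_pT hι hF.isSmooth h1 h2

theorem eventually_inducedBivector (hF : ν.IsNormalExtension x₀ f F)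
    (hG : ν.IsNormalExtension x₀ g G) (hι : Manifold.IsSmoothEmbedding (𝓡 n) (𝓡 m) ∞ ι)
    (Λ : BivField m M) :
    ∀ᶠ x in 𝓝 x₀, ν.inducedBivector hι Λ x (dif n f x) (dif n g x)
      = Λ (ι x) (dif m F (ι x)) (dif m G (ι x)) := by
  filter_upwards [hF.eventually_dif_comp_pT hι, hG.eventually_dif_comp_pT hι] with x h1 h2
  rw [ν.inducedBivector_apply, h1, h2]

theorem eventually_inducedVector (hF : ν.IsNormalExtension x₀ f F)
    (hι : Manifold.IsSmoothEmbedding (𝓡 n) (𝓡 m) ∞ ι) (E : VField m M) :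
    ∀ᶠ x in 𝓝 x₀, dif n f x (ν.inducedVector hι E x) = dif m F (ι x) (E (ι x)) := by
  filter_upwards [hF.eventually_dif_comp_pT hι] with x h1
  rw [← h1]
  rfl

theorem eventually_jacobiBracket (hF : ν.IsNormalExtension x₀ f F)
    (hG : ν.IsNormalExtension x₀ g G) (hι : Manifold.IsSmoothEmbedding (𝓡 n) (𝓡 m) ∞ ι)
    (Λ : BivField m M) (E : VField m M) :
    ∀ᶠ x in 𝓝 x₀, jacobiBracket Λ E F G (ι x)
      = jacobiBracket (ν.inducedBivector hι Λ) (ν.inducedVector hι E) f g x := by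
  filter_upwards [hF.eventually_inducedBivector hG hι Λ, hF.eventually_inducedVector hι E,
    hG.eventually_inducedVector hι E, hF.comp_eq, hG.comp_eq] with x h1 h2 h3 h4 h5
  rw [jacobiBracket, jacobiBracket, h1, h2, h3, h4, h5]

end Normalization.IsNormalExtension

/-- The induced bivector field is smooth, since it is given near each point by `Λ(dF, dG)` for
extensions `F`, `G` with differentials in `ann(νN)`. -/
theorem Normalization.isBivectorField_inducedBivector {ν : Normalization n m ι}
    (hν : ∀ (x₀ : N) (f : N → ℝ), IsSmooth n f → ∃ F, ν.IsNormalExtension x₀ f F)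
    (hι : Manifold.IsSmoothEmbedding (𝓡 n) (𝓡 m) ∞ ι) {Λ : BivField m M}
    (hΛ : IsBivectorField Λ) : IsBivectorField (ν.inducedBivector hι Λ) where
  alternating x α := hΛ.alternating _ _
  smooth f g hf hg x₀ := by
    obtain ⟨F, hF⟩ := hν x₀ f hf
    obtain ⟨G, hG⟩ := hν x₀ g hg
    exact ((hΛ.smooth F G hF.isSmooth hG.isSmooth).comp hι.contMDiff).contMDiffAt
      |>.congr_of_eventuallyEq (hF.eventually_inducedBivector hG hι Λ)

theorem Normalization.isVectorField_inducedVector [T2Space N] {ν : Normalization n m ι}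
    (hν : ∀ (x₀ : N) (f : N → ℝ), IsSmooth n f → ∃ F, ν.IsNormalExtension x₀ f F)
    (hι : Manifold.IsSmoothEmbedding (𝓡 n) (𝓡 m) ∞ ι) {E : VField m M}
    (hE : IsVectorField E) : IsVectorField (ν.inducedVector hι E) := by
  refine isVectorField_of_forall_isSmooth_apply fun f hf x₀ ↦ ?_
  obtain ⟨F, hF⟩ := hν x₀ f hf
  exact ((hE.isSmooth_apply hF.isSmooth).comp hι.contMDiff).contMDiffAt
    |>.congr_of_eventuallyEq (hF.eventually_inducedVector hι E)

/-- The component of `E` along `νN`. -/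
def Normalization.normalPart (hι : Manifold.IsSmoothEmbedding (𝓡 n) (𝓡 m) ∞ ι)
    (ν : Normalization n m ι) (E : VField m M) (x : N) : TangentSpace (𝓡 m) (ι x) :=
  E (ι x) - mfderiv (𝓡 n) (𝓡 m) ι x (ν.pT hι x (E (ι x)))

theorem Normalization.normalPart_mem_fiber (hι : Manifold.IsSmoothEmbedding (𝓡 n) (𝓡 m) ∞ ι)
    (ν : Normalization n m ι) (E : VField m M) (x : N) : ν.normalPart hι E x ∈ ν.fiber x :=
  ν.sub_pT_mem_fiber hι x _

/-- The brackets of `M` and of `N` compared on a function `K` that is only known to restrict to `k`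
and a function `H` with differential in `ann(νN)`: if the defect `Λ(dK - dk ∘ p_T, dH)` vanishes,
only the normal part of `E` contributes to the difference. -/
theorem Normalization.jacobiBracket_induced_eq (hι : Manifold.IsSmoothEmbedding (𝓡 n) (𝓡 m) ∞ ι)
    {ν : Normalization n m ι} {x₀ : N} {k h : N → ℝ} {K H : M → ℝ} (hK : IsSmooth m K)
    (hKk : ∀ᶠ x in 𝓝 x₀, K (ι x) = k x) (hH : ν.IsNormalExtension x₀ h H)
    (Λ : BivField m M) (E : VField m M)
    (hd : Λ (ι x₀) (dif m K (ι x₀)) (dif m H (ι x₀))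
      = Λ (ι x₀) ((dif n k x₀).comp (ν.pT hι x₀)) (dif m H (ι x₀))) :
    jacobiBracket (ν.inducedBivector hι Λ) (ν.inducedVector hι E) k h x₀
      = jacobiBracket Λ E K H (ι x₀) + h x₀ * dif m K (ι x₀) (ν.normalPart hι E x₀) := by
  have h1 := (hH.eventually_dif_comp_pT hι).self_of_nhds
  have h2 := (hH.eventually_inducedVector hι E).self_of_nhds
  have h3 : dif n k x₀ (ν.inducedVector hι E x₀)
      = dif m K (ι x₀) (E (ι x₀)) - dif m K (ι x₀) (ν.normalPart hι E x₀) := by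
    rw [dif_congr (g := fun x ↦ K (ι x)) (hKk.mono fun z hz ↦ hz.symm),
      dif_comp (hK.mdifferentiableAt _) (mdifferentiableAt_of_isSmoothEmbedding hι x₀),
      Normalization.normalPart, map_sub, sub_sub_cancel]
    rfl
  rw [jacobiBracket, jacobiBracket, ν.inducedBivector_apply, h1, hd, h2, h3,
    hH.comp_eq.self_of_nhds, hKk.self_of_nhds]
  ring

/-- If `Λ` is algebraically compatible, `Λ(·, dH)` is tangent to `N` for `dH` in `ann(νN)`, and so
it depends only on the restriction of its argument to `TN`. -/
theorem Normalization.CompatBivector.eq_comp_pT {ν : Normalization n m ι} {Λ : BivField m M}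
    (h : ν.CompatBivector Λ) (hΛ : IsBivectorField Λ)
    (hι : Manifold.IsSmoothEmbedding (𝓡 n) (𝓡 m) ∞ ι) {x₀ : N} {k : N → ℝ} {K : M → ℝ}
    (hK : IsSmooth m K) (hKk : ∀ᶠ x in 𝓝 x₀, K (ι x) = k x) {α : Covector m (ι x₀)}
    (hα : ν.InAnn x₀ α) :
    Λ (ι x₀) (dif m K (ι x₀)) α = Λ (ι x₀) ((dif n k x₀).comp (ν.pT hι x₀)) α := by
  obtain ⟨v, hv⟩ := h x₀ α hα
  rw [hΛ.swap, hΛ.swap _ α, hv, hv, ContinuousLinearMap.comp_apply, ν.pT_mfderiv hι,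
    dif_congr (g := fun x ↦ K (ι x)) (hKk.mono fun z hz ↦ hz.symm),
    dif_comp (hK.mdifferentiableAt _) (mdifferentiableAt_of_isSmoothEmbedding hι x₀)]

theorem Normalization.CompatVector.normalPart_eq_zero {ν : Normalization n m ι} {E : VField m M}
    (h : ν.CompatVector E) (hι : Manifold.IsSmoothEmbedding (𝓡 n) (𝓡 m) ∞ ι) (x : N) :
    ν.normalPart hι E x = 0 := by
  obtain ⟨v, hv⟩ := h x
  rw [Normalization.normalPart, hv, ν.pT_mfderiv hι, sub_self]

/-- The Jacobi identity at `x₀ ∈ N` for the induced bracket, from an adapted chart. The bracket of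
extensions `F`, `G`, `H` satisfies it on `M`, and in each of the three cases the two Jacobi sums
differ by the cyclic sum of `h (f A_g - g A_f)`, where `A_f` is the derivative of `dF(E)` along the
normal part of `E`; this sum vanishes identically. -/
theorem Normalization.IsAdaptedChart.jacobi_induced [T2Space M] {ν : Normalization n m ι}
    {φ : OpenPartialHomeomorph M (EuclideanSpace ℝ (Fin m))} {S : Set (Fin m)}
    (hφ : ν.IsAdaptedChart φ S) (hι : Manifold.IsSmoothEmbedding (𝓡 n) (𝓡 m) ∞ ι) {x₀ : N}
    (hx₀ : ι x₀ ∈ φ.source) {Λ : BivField m M} {E : VField m M} (hJ : IsJacobiStructure Λ E)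
    (hcond : (ν.CompatBivector Λ ∧ ν.CompatVector E) ∨
      ((∀ u ∈ S, ∀ v ∈ S, ν.InAnn x₀
        (dif m (fun z ↦ Λ z (dif m (fun p ↦ φ p u) z) (dif m (fun p ↦ φ p v) z)) (ι x₀))) ∧
      (ν.CompatBivector Λ ∨
        ∀ u ∈ S, ν.InAnn x₀ (dif m (fun z ↦ dif m (fun p ↦ φ p u) z (E z)) (ι x₀)))))
    {f g h : N → ℝ} (hf : IsSmooth n f) (hg : IsSmooth n g) (hh : IsSmooth n h) :
    jacobiBracket (ν.inducedBivector hι Λ) (ν.inducedVector hι E)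
        (jacobiBracket (ν.inducedBivector hι Λ) (ν.inducedVector hι E) f g) h x₀
      + jacobiBracket (ν.inducedBivector hι Λ) (ν.inducedVector hι E)
        (jacobiBracket (ν.inducedBivector hι Λ) (ν.inducedVector hι E) g h) f x₀
      + jacobiBracket (ν.inducedBivector hι Λ) (ν.inducedVector hι E)
        (jacobiBracket (ν.inducedBivector hι Λ) (ν.inducedVector hι E) h f) g x₀ = 0 := by
  have hιc : Continuous ι := hι.isEmbedding.continuous
  set Q := ν.normalPart hι E x₀ with hQ
  have hQν : Q ∈ ν.fiber x₀ := ν.normalPart_mem_fiber hι E x₀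
  have step : ∀ {f g h : N → ℝ} {F G H : M → ℝ} {a b c : Fin m → M → ℝ},
      ν.IsAdaptedExtension φ S x₀ f F a → ν.IsAdaptedExtension φ S x₀ g G b →
      ν.IsAdaptedExtension φ S x₀ h H c →
      jacobiBracket (ν.inducedBivector hι Λ) (ν.inducedVector hι E)
        (jacobiBracket (ν.inducedBivector hι Λ) (ν.inducedVector hι E) f g) h x₀
      = jacobiBracket Λ E (jacobiBracket Λ E F G) H (ι x₀)
        + h x₀ * (f x₀ * dif m (fun z ↦ dif m G z (E z)) (ι x₀) Q
          - g x₀ * dif m (fun z ↦ dif m F z (E z)) (ι x₀) Q) := by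
    intro f g h F G H a b c hF hG hH
    have nF := hF.isNormalExtension hφ hιc hx₀
    have nG := hG.isNormalExtension hφ hιc hx₀
    have nH := hH.isNormalExtension hφ hιc hx₀
    have hK := isSmooth_jacobiBracket hJ.isBivectorField hJ.isVectorField nF.isSmooth nG.isSmooth
    have hKk := nF.eventually_jacobiBracket nG hι Λ E
    have hHν := nH.inAnn.self_of_nhds
    have hfF := nF.comp_eq.self_of_nhds
    have hgG := nG.comp_eq.self_of_nhds
    have hd : (∀ u ∈ S, ∀ v ∈ S, ν.InAnn x₀
        (dif m (fun z ↦ Λ z (dif m (fun p ↦ φ p u) z) (dif m (fun p ↦ φ p v) z)) (ι x₀))) →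
        ∀ w ∈ ν.fiber x₀, dif m (jacobiBracket Λ E F G) (ι x₀) w
          = f x₀ * dif m (fun z ↦ dif m G z (E z)) (ι x₀) w
            - g x₀ * dif m (fun z ↦ dif m F z (E z)) (ι x₀) w := by
      intro hc w hw
      rw [← hfF, ← hgG]
      exact ν.dif_jacobiBracket_of_mem_fiber hJ.isVectorField nF.isSmooth nG.isSmooth
        nF.inAnn.self_of_nhds nG.inAnn.self_of_nhds
        (hF.killsNormal_bivector hJ.isBivectorField hG hφ hx₀ hc) hw
    rcases hcond with ⟨hΛ, hE⟩ | ⟨hc, hΛ | hE⟩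
    · rw [ν.jacobiBracket_induced_eq hι hK hKk nH Λ E
        (hΛ.eq_comp_pT hJ.isBivectorField hι hK hKk hHν), hQ, hE.normalPart_eq_zero hι]
      simp
    · rw [ν.jacobiBracket_induced_eq hι hK hKk nH Λ E
        (hΛ.eq_comp_pT hJ.isBivectorField hι hK hKk hHν), hd hc _ hQν]
    · have hKν : ν.InAnn x₀ (dif m (jacobiBracket Λ E F G) (ι x₀)) := by
        intro w hw
        rw [hd hc w hw, (hF.killsNormal_vector hJ.isVectorField hφ hx₀ hE).2 w hw,
          (hG.killsNormal_vector hJ.isVectorField hφ hx₀ hE).2 w hw, mul_zero, mul_zero, sub_zero]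
      rw [ν.jacobiBracket_induced_eq hι hK hKk nH Λ E
        (by rw [ν.dif_comp_pT hι hK hKk hKν]), hd hc _ hQν]
  obtain ⟨F, a, hF⟩ := hφ.exists_isAdaptedExtension hι hx₀ hf
  obtain ⟨G, b, hG⟩ := hφ.exists_isAdaptedExtension hι hx₀ hg
  obtain ⟨H, c, hH⟩ := hφ.exists_isAdaptedExtension hι hx₀ hh
  have hM := hJ.jacobi F G H hF.isSmooth hG.isSmooth hH.isSmooth (ι x₀)
  rw [step hF hG hH, step hG hH hF, step hH hF hG]
  linear_combination hM

end Induced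

/-! ### A chart from the inverse function theorem -/

section Existence

variable {m : ℕ} {M : Type*} [TopologicalSpace M] [ChartedSpace (EuclideanSpace ℝ (Fin m)) M]
  [IsManifold (𝓡 m) ∞ M]

/-- The inverse function theorem for changes of charts: if `Ψ` is smooth on `O` with invertible
derivative at `y₀` and `Ψ y₀ = c p`, then `Ψ⁻¹ ∘ c` is a chart around `p`, for the local inverse of
`Ψ` that maps `c p` to `y₀`. -/
theorem exists_chart_of_hasFDerivAt {c : OpenPartialHomeomorph M (EuclideanSpace ℝ (Fin m))}
    (hc : c ∈ IsManifold.maximalAtlas (𝓡 m) ∞ M)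
    {Ψ : EuclideanSpace ℝ (Fin m) → EuclideanSpace ℝ (Fin m)} {O : Set (EuclideanSpace ℝ (Fin m))}
    (hO : IsOpen O) (hΨ : ContDiffOn ℝ ∞ Ψ O) {y₀ : EuclideanSpace ℝ (Fin m)} (hy₀ : y₀ ∈ O)
    {L : EuclideanSpace ℝ (Fin m) ≃L[ℝ] EuclideanSpace ℝ (Fin m)}
    (hL : HasFDerivAt Ψ (L : EuclideanSpace ℝ (Fin m) →L[ℝ] EuclideanSpace ℝ (Fin m)) y₀)
    {p : M} (hp : p ∈ c.source) (hcp : Ψ y₀ = c p) :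
    ∃ φ ∈ IsManifold.maximalAtlas (𝓡 m) ∞ M, p ∈ φ.source ∧ φ p = y₀ ∧ φ.source ⊆ c.source ∧
      φ.target ⊆ O ∧ (∀ z ∈ φ.source, Ψ (φ z) = c z) ∧
      ∀ y ∈ φ.target, φ.symm y = c.symm (Ψ y) := by
  have hΨ₀ : ContDiffAt ℝ ∞ Ψ y₀ := hΨ.contDiffAt (hO.mem_nhds hy₀)
  -- smoothness of the inverse needs an invertible derivative also at the points near `y₀`
  set O' := O ∩ fderiv ℝ Ψ ⁻¹' Set.range
    ((↑) : (EuclideanSpace ℝ (Fin m) ≃L[ℝ] EuclideanSpace ℝ (Fin m)) →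
      EuclideanSpace ℝ (Fin m) →L[ℝ] EuclideanSpace ℝ (Fin m)) with hO'
  have hO'o : IsOpen O' :=
    (hΨ.continuousOn_fderiv_of_isOpen hO (by simp)).isOpen_inter_preimage hO
      ContinuousLinearEquiv.isOpen
  set R := (hΨ₀.toOpenPartialHomeomorph Ψ hL (by simp)).restrOpen O' hO'o with hR
  have hRs : ∀ {y}, y ∈ R.source → y ∈ O' := fun hy ↦ hy.2
  have hRΨ : ∀ y, R y = Ψ y := fun y ↦ rfl
  have hy₀R : y₀ ∈ R.source :=
    ⟨hΨ₀.mem_toOpenPartialHomeomorph_source hL (by simp), hy₀, ⟨L, hL.fderiv.symm⟩⟩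
  have hRsm : ContDiffOn ℝ ∞ R.symm R.target := by
    intro y hy
    have hy' := R.map_target hy
    obtain ⟨L', hL'⟩ := (hRs hy').2
    have hd : ContDiffAt ℝ ∞ Ψ (R.symm y) := hΨ.contDiffAt (hO.mem_nhds (hRs hy').1)
    refine (R.contDiffAt_symm (f₀' := L') hy ?_ hd).contDiffWithinAt
    rw [hL']
    exact (hd.differentiableAt (by simp)).hasFDerivAt
  refine ⟨c.trans R.symm, ?_, ?_, ?_, ?_, ?_, ?_, ?_⟩
  · refine OpenPartialHomeomorph.mem_maximalAtlas_of_contMDiffOn _ ?_ ?_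
    · exact hRsm.contMDiffOn.comp
        ((contMDiffOn_of_mem_maximalAtlas hc).mono fun z hz ↦ hz.1) fun z hz ↦ hz.2
    · exact (contMDiffOn_symm_of_mem_maximalAtlas hc).comp
        ((hΨ.mono fun y hy ↦ (hRs hy.1).1).contMDiffOn) fun z hz ↦ hz.2
  · refine ⟨hp, ?_⟩
    change c p ∈ R.target
    rw [← hcp, ← hRΨ]
    exact R.map_source hy₀R
  · change R.symm (c p) = y₀
    rw [← hcp, ← hRΨ, R.left_inv hy₀R]
  · exact fun z hz ↦ hz.1
  · exact fun y hy ↦ (hRs hy.1).1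
  · intro z hz
    exact R.right_inv hz.2
  · intro y hy
    rfl

end Existence

/-! ### Existence of adapted charts -/

section Existence

variable {n m : ℕ}
  {N : Type*} [TopologicalSpace N] [ChartedSpace (EuclideanSpace ℝ (Fin n)) N]
  {M : Type*} [TopologicalSpace M] [ChartedSpace (EuclideanSpace ℝ (Fin m)) M] {ι : N → M}

/-- The first block of coordinates, for a splitting `σ` of the coordinates into two blocks. -/
def blockProj {k : ℕ} (σ : Fin m ≃ Fin n ⊕ Fin k) :
    EuclideanSpace ℝ (Fin m) →L[ℝ] EuclideanSpace ℝ (Fin n) :=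
  (PiLp.continuousLinearEquiv 2 ℝ (fun _ : Fin n ↦ ℝ)).symm.toContinuousLinearMap ∘L
    ContinuousLinearMap.pi fun j ↦ EuclideanSpace.proj (σ.symm (Sum.inl j))

/-- The inclusion of the first block of coordinates, with zeros in the second one. -/
def blockIncl {k : ℕ} (σ : Fin m ≃ Fin n ⊕ Fin k) :
    EuclideanSpace ℝ (Fin n) →L[ℝ] EuclideanSpace ℝ (Fin m) :=
  (PiLp.continuousLinearEquiv 2 ℝ (fun _ : Fin m ↦ ℝ)).symm.toContinuousLinearMap ∘L
    ContinuousLinearMap.pi fun u ↦ Sum.elim (fun j ↦ EuclideanSpace.proj j) (fun _ ↦ 0) (σ u)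

section Block

variable {k : ℕ} (σ : Fin m ≃ Fin n ⊕ Fin k)

@[simp] theorem blockProj_apply (y : EuclideanSpace ℝ (Fin m)) (j : Fin n) :
    blockProj σ y j = y (σ.symm (Sum.inl j)) := rfl

@[simp] theorem blockIncl_inl (v : EuclideanSpace ℝ (Fin n)) (j : Fin n) :
    blockIncl σ v (σ.symm (Sum.inl j)) = v j := by
  simp [blockIncl]

@[simp] theorem blockIncl_inr (v : EuclideanSpace ℝ (Fin n)) (i : Fin k) :
    blockIncl σ v (σ.symm (Sum.inr i)) = 0 := by
  simp [blockIncl]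

@[simp] theorem blockProj_blockIncl (v : EuclideanSpace ℝ (Fin n)) :
    blockProj σ (blockIncl σ v) = v := by
  ext j
  simp

theorem block_ext {y z : EuclideanSpace ℝ (Fin m)} (h₁ : blockProj σ y = blockProj σ z)
    (h₂ : ∀ i, y (σ.symm (Sum.inr i)) = z (σ.symm (Sum.inr i))) : y = z := by
  ext u
  obtain ⟨s, rfl⟩ := σ.symm.surjective u
  rcases s with j | i
  · exact congrArg (fun v : EuclideanSpace ℝ (Fin n) ↦ v j) h₁
  · exact h₂ i

/-- The map `(v, c) ↦ j v + ∑ cᵢ Tᵢ(v)`, linear in the second block of coordinates: with `j v`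
running through `N` and `Tᵢ` a frame of `νN`, it sends the second block of coordinate directions to
`νN` along `N`. -/
def frameMap (j : EuclideanSpace ℝ (Fin n) →L[ℝ] EuclideanSpace ℝ (Fin m))
    (T : Fin k → EuclideanSpace ℝ (Fin n) → EuclideanSpace ℝ (Fin m))
    (y : EuclideanSpace ℝ (Fin m)) : EuclideanSpace ℝ (Fin m) :=
  j (blockProj σ y) + ∑ i, y (σ.symm (Sum.inr i)) • T i (blockProj σ y)

/-- The derivative of `frameMap` at the points `(v, 0)`. -/
def frameDeriv (j : EuclideanSpace ℝ (Fin n) →L[ℝ] EuclideanSpace ℝ (Fin m))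
    (T : Fin k → EuclideanSpace ℝ (Fin m)) :
    EuclideanSpace ℝ (Fin m) →L[ℝ] EuclideanSpace ℝ (Fin m) :=
  j ∘L blockProj σ + ∑ i, (EuclideanSpace.proj (σ.symm (Sum.inr i))).smulRight (T i)

variable {j : EuclideanSpace ℝ (Fin n) →L[ℝ] EuclideanSpace ℝ (Fin m)}

theorem frameDeriv_apply (T : Fin k → EuclideanSpace ℝ (Fin m)) (z : EuclideanSpace ℝ (Fin m)) :
    frameDeriv σ j T z = j (blockProj σ z) + ∑ i, z (σ.symm (Sum.inr i)) • T i := by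
  simp [frameDeriv]

theorem frameMap_blockIncl (T : Fin k → EuclideanSpace ℝ (Fin n) → EuclideanSpace ℝ (Fin m))
    (v : EuclideanSpace ℝ (Fin n)) : frameMap σ j T (blockIncl σ v) = j v := by
  simp [frameMap]

theorem contDiffOn_frameMap {T : Fin k → EuclideanSpace ℝ (Fin n) → EuclideanSpace ℝ (Fin m)}
    {D : Set (EuclideanSpace ℝ (Fin n))} (hT : ∀ i, ContDiffOn ℝ ∞ (T i) D) :
    ContDiffOn ℝ ∞ (frameMap σ j T) (blockProj σ ⁻¹' D) := by
  refine (j.contDiff.comp (blockProj σ).contDiff).contDiffOn.add (ContDiffOn.sum fun i _ ↦ ?_)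
  exact (EuclideanSpace.proj (𝕜 := ℝ) (σ.symm (Sum.inr i))).contDiff.contDiffOn.smul
    ((hT i).comp (blockProj σ).contDiff.contDiffOn fun y hy ↦ hy)

theorem hasFDerivAt_frameMap {T : Fin k → EuclideanSpace ℝ (Fin n) → EuclideanSpace ℝ (Fin m)}
    {v : EuclideanSpace ℝ (Fin n)} (hT : ∀ i, DifferentiableAt ℝ (T i) v) :
    HasFDerivAt (frameMap σ j T) (frameDeriv σ j fun i ↦ T i v) (blockIncl σ v) := by
  refine HasFDerivAt.add (j.hasFDerivAt.comp _ (blockProj σ).hasFDerivAt)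
    (HasFDerivAt.fun_sum fun i _ ↦ ?_)
  have h1 : HasFDerivAt (fun y ↦ T i (blockProj σ y)) ((fderiv ℝ (T i) v).comp (blockProj σ))
      (blockIncl σ v) :=
    HasFDerivAt.comp (f := blockProj σ) _ (by simpa using (hT i).hasFDerivAt)
      (blockProj σ).hasFDerivAt
  have h2 := (EuclideanSpace.proj (𝕜 := ℝ) (σ.symm (Sum.inr i))).hasFDerivAt
    (x := blockIncl σ v)
  have h3 : HasFDerivAt (fun y ↦ y (σ.symm (Sum.inr i)) • T i (blockProj σ y)) _ _ := h2.smul h1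
  simpa using h3

end Block

variable [IsManifold (𝓡 m) ∞ M]

/-- A smooth section of `TM|_N` read in a chart of `M` is smooth. -/
theorem contMDiffAt_mvfderiv_chart_apply [T2Space M]
    {c : OpenPartialHomeomorph M (EuclideanSpace ℝ (Fin m))}
    (hc : c ∈ IsManifold.maximalAtlas (𝓡 m) ∞ M) {s : ∀ x : N, TangentSpace (𝓡 m) (ι x)} {x₀ : N}
    (hι : ContinuousAt ι x₀) (hx₀ : ι x₀ ∈ c.source)
    (hs : ContMDiffAt (𝓡 n) (𝓡 m).tangent ∞
      (fun x ↦ (⟨ι x, s x⟩ : TangentBundle (𝓡 m) M)) x₀) :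
    ContMDiffAt (𝓡 n) (𝓡 m) ∞ (fun x ↦ mvfderiv (𝓡 m) c (ι x) (s x)) x₀ := by
  have key : ∀ u : Fin m, ContMDiffAt (𝓡 n) 𝓘(ℝ, ℝ) ∞
      (fun x ↦ mvfderiv (𝓡 m) c (ι x) (s x) u) x₀ := by
    intro u
    obtain ⟨F, hF, hFe⟩ := exists_isSmooth_eventuallyEq_chart hc hx₀ u
    refine (contMDiffAt_dif_apply hs hF).congr_of_eventuallyEq ?_
    filter_upwards [hι.eventually (eventually_dif_eq (m := m) hFe),
      hι.eventually (c.open_source.mem_nhds hx₀)] with x h1 h2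
    rw [h1, dif_chart_apply hc h2]
  have : ContMDiffAt (𝓡 n) 𝓘(ℝ, Fin m → ℝ) ∞
      (fun x ↦ WithLp.ofLp (mvfderiv (𝓡 m) c (ι x) (s x))) x₀ := contMDiffAt_pi_space.2 key
  exact (PiLp.continuousLinearEquiv 2 ℝ
    (fun _ : Fin m ↦ ℝ)).symm.contDiff.contMDiff.contMDiffAt.comp x₀ this

variable [IsManifold (𝓡 n) ∞ N]

theorem Normalization.add_eq_of_frame (hι : Manifold.IsSmoothEmbedding (𝓡 n) (𝓡 m) ∞ ι)
    (ν : Normalization n m ι) {x : N} {k : ℕ} {s : Fin k → TangentSpace (𝓡 m) (ι x)}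
    (hs : LinearIndependent ℝ s) (hspan : Submodule.span ℝ (Set.range s) = ν.fiber x) :
    n + k = m := by
  have h1 : Module.finrank ℝ (LinearMap.range (mfderiv (𝓡 n) (𝓡 m) ι x).toLinearMap) = n := by
    rw [LinearMap.finrank_range_of_inj (mfderiv_injective hι x)]
    exact finrank_euclideanSpace_fin
  have h2 : Module.finrank ℝ (ν.fiber x) = k := by
    rw [← hspan, finrank_span_eq_card hs, Fintype.card_fin]
  have : FiniteDimensional ℝ (TangentSpace (𝓡 m) (ι x)) :=
    inferInstanceAs (FiniteDimensional ℝ (EuclideanSpace ℝ (Fin m)))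
  have h3 := Submodule.finrank_add_eq_of_isCompl (ν.isCompl x)
  have h4 : Module.finrank ℝ (TangentSpace (𝓡 m) (ι x)) = m := finrank_euclideanSpace_fin
  omega

/-- A frame of `νN` and a chart of `N` span `TM|_N`. -/
theorem Normalization.frameDeriv_injective (hι : Manifold.IsSmoothEmbedding (𝓡 n) (𝓡 m) ∞ ι)
    (ν : Normalization n m ι) {d : OpenPartialHomeomorph N (EuclideanSpace ℝ (Fin n))}
    {c : OpenPartialHomeomorph M (EuclideanSpace ℝ (Fin m))}
    {j : EuclideanSpace ℝ (Fin n) →L[ℝ] EuclideanSpace ℝ (Fin m)}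
    (hd : d ∈ IsManifold.maximalAtlas (𝓡 n) ∞ N) (hc : c ∈ IsManifold.maximalAtlas (𝓡 m) ∞ M)
    (hloc : ∀ z ∈ d.source, ι z ∈ c.source ∧ c (ι z) = j (d z)) {x : N} (hx : x ∈ d.source)
    {k : ℕ} (σ : Fin m ≃ Fin n ⊕ Fin k) {s : Fin k → TangentSpace (𝓡 m) (ι x)}
    (hs : LinearIndependent ℝ s) (hspan : Submodule.span ℝ (Set.range s) = ν.fiber x) :
    Function.Injective (frameDeriv σ j fun i ↦ mvfderiv (𝓡 m) c (ι x) (s i)) := by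
  have hj : ∀ t : TangentSpace (𝓡 n) x, mvfderiv (𝓡 m) c (ι x) (mfderiv (𝓡 n) (𝓡 m) ι x t)
      = j (mvfderiv (𝓡 n) d x t) := by
    intro t
    have h1 : c ∘ ι =ᶠ[𝓝 x] j ∘ d := by
      filter_upwards [d.open_source.mem_nhds hx] with z hz using (hloc z hz).2
    have h2 := h1.mfderiv_eq (I := 𝓡 n) (I' := 𝓡 m)
    rw [mfderiv_comp x ((chart_mdifferentiable hc).mdifferentiableAt (hloc x hx).1)
      (mdifferentiableAt_of_isSmoothEmbedding hι x),
      mfderiv_comp (I' := 𝓡 n) x j.differentiableAt.mdifferentiableAt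
      ((chart_mdifferentiable hd).mdifferentiableAt hx), mfderiv_eq_fderiv,
      ContinuousLinearMap.fderiv] at h2
    exact congrArg (fun L : EuclideanSpace ℝ (Fin n) →L[ℝ] EuclideanSpace ℝ (Fin m) ↦ L t) h2
  rw [injective_iff_map_eq_zero]
  intro z hz
  obtain ⟨t, ht⟩ := (mvfderiv_chart_bijective hd hx).2 (blockProj σ z)
  have hsum : mvfderiv (𝓡 m) c (ι x) (mfderiv (𝓡 n) (𝓡 m) ι x t
      + ∑ i, z (σ.symm (Sum.inr i)) • s i) = 0 := by
    rw [map_add, hj, ht, map_sum]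
    simp only [map_smul]
    rw [← hz, frameDeriv_apply]
  have h0 := (mvfderiv_chart_bijective hc (hloc x hx).1).1 (hsum.trans (map_zero _).symm)
  have hmem : ∑ i, z (σ.symm (Sum.inr i)) • s i ∈ ν.fiber x := by
    rw [← hspan]
    exact Submodule.sum_mem _ fun i _ ↦
      Submodule.smul_mem _ _ (Submodule.subset_span (Set.mem_range_self i))
  have ht0 : t = 0 := by
    have := congrArg (ν.pT hι x) h0
    rwa [map_add, ν.pT_mfderiv hι, ν.pT_of_mem_fiber hι x hmem, add_zero, map_zero] at this
  rw [ht0, map_zero, zero_add] at h0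
  refine block_ext σ ?_ fun i ↦ ?_
  · rw [← ht, ht0, map_zero, map_zero]
  · exact Fintype.linearIndependent_iff.1 hs _ h0 i

/-- Every normalization has adapted charts. With a local frame `sᵢ` of `νN`, the coordinates are
those in which `N` and `νN` are linear: the inverse of `(v, c) ↦ v + ∑ cᵢ sᵢ(v)`, read in a chart in
which `N` is a linear subspace. -/
theorem Normalization.exists_isAdaptedChart [T2Space M]
    (hι : Manifold.IsSmoothEmbedding (𝓡 n) (𝓡 m) ∞ ι) (ν : Normalization n m ι) (x₀ : N) :
    ∃ φ S, ν.IsAdaptedChart φ S ∧ ι x₀ ∈ φ.source := by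
  have hιc : Continuous ι := hι.isEmbedding.continuous
  obtain ⟨d, c, j, q, hd, hc, hx₀, hloc, hqj⟩ := exists_charts_linear hι x₀
  obtain ⟨U, hU, k, s, hs, hframe⟩ := ν.exists_frame x₀
  have hxU : x₀ ∈ interior U := mem_interior_iff_mem_nhds.2 hU
  have hnk : n + k = m :=
    ν.add_eq_of_frame hι (hframe x₀ (interior_subset hxU)).1 (hframe x₀ (interior_subset hxU)).2
  obtain ⟨σ⟩ : Nonempty (Fin m ≃ Fin n ⊕ Fin k) :=
    Fintype.card_eq.1 (by simp [hnk])
  -- the frame, read in the chart `c` and as a function of the coordinates of `N`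
  set T : Fin k → EuclideanSpace ℝ (Fin n) → EuclideanSpace ℝ (Fin m) := fun i v ↦
    mvfderiv (𝓡 m) c (ι (d.symm v)) (s i (d.symm v)) with hT
  set D : Set (EuclideanSpace ℝ (Fin n)) := d.target ∩ d.symm ⁻¹' interior U with hD
  have hDo : IsOpen D := d.symm.isOpen_inter_preimage isOpen_interior
  have hTs : ∀ i, ContDiffOn ℝ ∞ (T i) D := by
    intro i
    refine ContMDiffOn.contDiffOn ?_
    intro v hv
    refine ContMDiffAt.contMDiffWithinAt ?_
    refine ContMDiffAt.comp (g := fun x ↦ mvfderiv (𝓡 m) c (ι x) (s i x)) v ?_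
      ((contMDiffOn_symm_of_mem_maximalAtlas hd).contMDiffAt (d.open_target.mem_nhds hv.1))
    exact contMDiffAt_mvfderiv_chart_apply hc hιc.continuousAt (hloc _ (d.map_target hv.1)).1
      ((hs i).contMDiffAt (mem_interior_iff_mem_nhds.1 hv.2))
  have hTx : ∀ x ∈ d.source, ∀ i, T i (d x) = mvfderiv (𝓡 m) c (ι x) (s i x) := by
    intro x hx i
    simp only [hT]
    rw [d.left_inv hx]
  have hdD : ∀ x ∈ d.source, x ∈ interior U → d x ∈ D := fun x hx hxU ↦
    ⟨d.map_source hx, by rwa [Set.mem_preimage, d.left_inv hx]⟩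
  set Ψ := frameMap σ j T with hΨ
  have hΨd : ∀ x ∈ d.source, x ∈ interior U → HasFDerivAt Ψ
      (frameDeriv σ j fun i ↦ mvfderiv (𝓡 m) c (ι x) (s i x)) (blockIncl σ (d x)) := by
    intro x hx hxU
    have := hasFDerivAt_frameMap σ (j := j) (T := T) (v := d x) fun i ↦
      ((hTs i).contDiffAt (hDo.mem_nhds (hdD x hx hxU))).differentiableAt (by simp)
    simpa only [hTx x hx] using this
  have hinj : ∀ x ∈ d.source, x ∈ interior U → Function.Injective
      (frameDeriv σ j fun i ↦ mvfderiv (𝓡 m) c (ι x) (s i x)) := fun x hx hxU ↦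
    ν.frameDeriv_injective hι hd hc hloc hx σ (hframe x (interior_subset hxU)).1
      (hframe x (interior_subset hxU)).2
  obtain ⟨L, hL⟩ : ∃ L : EuclideanSpace ℝ (Fin m) ≃L[ℝ] EuclideanSpace ℝ (Fin m),
      (L : EuclideanSpace ℝ (Fin m) →L[ℝ] EuclideanSpace ℝ (Fin m))
        = frameDeriv σ j fun i ↦ mvfderiv (𝓡 m) c (ι x₀) (s i x₀) :=
    ⟨(LinearEquiv.ofInjectiveEndo _ (hinj x₀ hx₀ hxU)).toContinuousLinearEquiv, by ext; rfl⟩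
  obtain ⟨φ, hφ, hφx, hφx', hφc, hφD, hφΨ, hφs⟩ := exists_chart_of_hasFDerivAt hc
    (hDo.preimage (blockProj σ).continuous) (contDiffOn_frameMap σ (j := j) hTs)
    (y₀ := blockIncl σ (d x₀)) (by simpa using hdD x₀ hx₀ hxU) (hL ▸ hΨd x₀ hx₀ hxU)
    (hloc x₀ hx₀).1 (by rw [frameMap_blockIncl, (hloc x₀ hx₀).2])
  -- the part of `N` on which `φ` is controlled, and open subsets of `M` and `ℝⁿ` that cut it out
  set U' : Set N := (d.source ∩ d ⁻¹' (blockIncl σ ⁻¹' φ.target)) ∩ interior U with hU'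
  have hU'o : IsOpen U' := (d.isOpen_inter_preimage
    (φ.open_target.preimage (blockIncl σ).continuous)).inter isOpen_interior
  obtain ⟨V, hV, hVU⟩ := hι.isEmbedding.isInducing.isOpen_iff.1 hU'o
  have hx₀U' : x₀ ∈ U' := ⟨⟨hx₀, by
    change blockIncl σ (d x₀) ∈ φ.target
    rw [← hφx']
    exact φ.map_source hφx⟩, hxU⟩
  set D' : Set (EuclideanSpace ℝ (Fin n)) := d.target ∩ d.symm ⁻¹' U' with hD'
  have hD'o : IsOpen D' := d.symm.isOpen_inter_preimage hU'o
  have hφι : ∀ x ∈ U', ι x ∈ φ.source ∧ φ (ι x) = blockIncl σ (d x) := by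
    intro x hx
    have h1 : φ.symm (blockIncl σ (d x)) = ι x := by
      rw [hφs _ hx.1.2, frameMap_blockIncl, ← (hloc x hx.1.1).2, c.left_inv (hloc x hx.1.1).1]
    rw [← h1]
    exact ⟨φ.map_target hx.1.2, φ.right_inv hx.1.2⟩
  set W : Set M := V ∩ (φ.source ∩ φ ⁻¹' (blockProj σ ⁻¹' D')) with hW
  have hWo : IsOpen W :=
    hV.inter (φ.isOpen_inter_preimage (hD'o.preimage (blockProj σ).continuous))
  have hsrc : ∀ {z}, z ∈ (φ.restr W).source ↔ z ∈ φ.source ∧ z ∈ W := by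
    intro z
    rw [φ.restr_source, hWo.interior_eq]
    rfl
  refine ⟨φ.restr W, {u | (σ u).isLeft}, ⟨?_, ?_, ?_⟩, ?_⟩
  · exact restr_mem_maximalAtlas (contDiffGroupoid ∞ (𝓡 m)) hφ hWo
  · intro z hz
    obtain ⟨hzφ, hzV, -, hzD⟩ := hsrc.1 hz
    rw [OpenPartialHomeomorph.restr_apply]
    constructor
    · rintro ⟨x, rfl⟩ a ha
      have hx : x ∈ U' := by rw [← hVU]; exact hzV
      rw [(hφι x hx).2]
      obtain ⟨t, rfl⟩ := σ.symm.surjective a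
      rcases t with t | t
      · simp at ha
      · exact blockIncl_inr σ _ t
    · intro hz0
      have hx : d.symm (blockProj σ (φ z)) ∈ U' := hzD.2
      refine ⟨_, φ.injOn (hφι _ hx).1 hzφ ?_⟩
      rw [(hφι _ hx).2, d.right_inv hzD.1]
      refine block_ext σ (blockProj_blockIncl σ _) fun i ↦ ?_
      rw [blockIncl_inr, hz0 _ (by simp)]
  · intro x hx u hu
    obtain ⟨hxφ, hxV, -⟩ := hsrc.1 hx
    have hxU' : x ∈ U' := by rw [← hVU]; exact hxV
    have hxd : x ∈ d.source := hxU'.1.1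
    have hchain : ∀ w : TangentSpace (𝓡 m) (ι x), mvfderiv (𝓡 m) c (ι x) w
        = frameDeriv σ j (fun i ↦ mvfderiv (𝓡 m) c (ι x) (s i x)) (mvfderiv (𝓡 m) φ (ι x) w) := by
      intro w
      have h1 : c =ᶠ[𝓝 (ι x)] Ψ ∘ φ := by
        filter_upwards [φ.open_source.mem_nhds hxφ] with z hz using (hφΨ z hz).symm
      have h2 := h1.mfderiv_eq (I := 𝓡 m) (I' := 𝓡 m)
      have h3 : HasFDerivAt Ψ (frameDeriv σ j fun i ↦ mvfderiv (𝓡 m) c (ι x) (s i x))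
          (φ (ι x)) := by
        rw [(hφι x hxU').2]
        exact hΨd x hxd hxU'.2
      rw [mfderiv_comp (I' := 𝓡 m) (ι x) h3.differentiableAt.mdifferentiableAt
        ((chart_mdifferentiable hφ).mdifferentiableAt hxφ), mfderiv_eq_fderiv, h3.fderiv] at h2
      exact congrArg (fun L : EuclideanSpace ℝ (Fin m) →L[ℝ] EuclideanSpace ℝ (Fin m) ↦ L w) h2
    have hsi : ∀ i, mvfderiv (𝓡 m) φ (ι x) (s i x)
        = EuclideanSpace.single (σ.symm (Sum.inr i)) 1 := by
      intro i
      apply hinj x hxd hxU'.2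
      rw [← hchain, frameDeriv_apply]
      have : blockProj σ (EuclideanSpace.single (σ.symm (Sum.inr i)) (1 : ℝ)) = 0 := by
        ext l
        simp
      rw [this, map_zero, zero_add]
      simp
    intro w hw
    rw [← (hframe x (interior_subset hxU'.2)).2] at hw
    have hle : Submodule.span ℝ (Set.range fun i ↦ s i x)
        ≤ LinearMap.ker (dif m (fun z ↦ (φ.restr W) z u) (ι x)).toLinearMap := by
      rw [Submodule.span_le]
      rintro _ ⟨i, rfl⟩
      change dif m (fun z ↦ φ z u) (ι x) (s i x) = 0
      rw [dif_chart_apply hφ hxφ, hsi]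
      have : u ≠ σ.symm (Sum.inr i) := by
        rintro rfl
        simp at hu
      simp [this]
    exact hle hw
  · refine hsrc.2 ⟨hφx, ?_, hφx, ?_⟩
    · change x₀ ∈ ι ⁻¹' V
      rw [hVU]
      exact hx₀U'
    · change blockProj σ (φ (ι x₀)) ∈ D'
      rw [hφx', blockProj_blockIncl]
      exact ⟨d.map_source hx₀, by rwa [Set.mem_preimage, d.left_inv hx₀]⟩

end Existence

/-! ### The induced Jacobi structure -/

section Main

variable {n m : ℕ}
  {N : Type*} [TopologicalSpace N] [ChartedSpace (EuclideanSpace ℝ (Fin n)) N]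
  [IsManifold (𝓡 n) ∞ N]
  {M : Type*} [TopologicalSpace M] [T2Space M] [ChartedSpace (EuclideanSpace ℝ (Fin m)) M]
  [IsManifold (𝓡 m) ∞ M] {ι : N → M}

theorem Normalization.exists_isNormalExtension (hι : Manifold.IsSmoothEmbedding (𝓡 n) (𝓡 m) ∞ ι)
    (ν : Normalization n m ι) (x₀ : N) {f : N → ℝ} (hf : IsSmooth n f) :
    ∃ F, ν.IsNormalExtension x₀ f F := by
  obtain ⟨φ, S, hφ, hx₀⟩ := ν.exists_isAdaptedChart hι x₀
  obtain ⟨F, a, hF⟩ := hφ.exists_isAdaptedExtension hι hx₀ hf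
  exact ⟨F, hF.isNormalExtension hφ hι.isEmbedding.continuous hx₀⟩

theorem Normalization.isJacobiStructure_induced (hι : Manifold.IsSmoothEmbedding (𝓡 n) (𝓡 m) ∞ ι)
    {Λ : BivField m M} {E : VField m M} (hJ : IsJacobiStructure Λ E) (ν : Normalization n m ι)
    (h : ν.IsAlmostDirac Λ ∨ ν.IsAJC Λ E ∨ ν.IsQuasiDirac Λ E ∨ ν.IsCoordQuasiDirac Λ E) :
    IsJacobiStructure (ν.inducedBivector hι Λ) (ν.inducedVector hι E) := by
  have : T2Space N := hι.isEmbedding.t2Space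
  have hext := fun (x₀ : N) (f : N → ℝ) (hf : IsSmooth n f) ↦
    ν.exists_isNormalExtension hι x₀ hf
  refine ⟨Normalization.isBivectorField_inducedBivector hext hι hJ.isBivectorField,
    Normalization.isVectorField_inducedVector hext hι hJ.isVectorField,
    fun f g k hf hg hk x₀ ↦ ?_⟩
  obtain ⟨φ, S, hφ, hx₀⟩ := ν.exists_isAdaptedChart hι x₀
  -- the quasi-Dirac condition in coordinates comes with charts of its own
  rcases h with ⟨hΛ, hΛs⟩ | hA | ⟨hΛs, hEs⟩ | hC
  · exact hφ.jacobi_induced hι hx₀ hJ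
      (.inr ⟨fun u hu v hv ↦ hΛs.inAnn_dif_coord hφ hι hx₀ hu hv, .inl hΛ⟩) hf hg hk
  · exact hφ.jacobi_induced hι hx₀ hJ (.inl hA) hf hg hk
  · exact hφ.jacobi_induced hι hx₀ hJ
      (.inr ⟨fun u hu v hv ↦ hΛs.inAnn_dif_coord hφ hι hx₀ hu hv,
        .inr fun u hu ↦ hEs.inAnn_dif_coord hJ.isVectorField hφ hι hx₀ hu⟩) hf hg hk
  · obtain ⟨φ, S, hφ, hx₀, hc⟩ := hC x₀
    exact hφ.jacobi_induced hι hx₀ hJ (.inr ⟨(hc x₀ hx₀).1, .inr (hc x₀ hx₀).2⟩) hf hg hk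

end Main

end JacobiGeometry
end

theorem proposition3p1 {n m : ℕ}
    {N : Type*} [TopologicalSpace N] [ChartedSpace (EuclideanSpace ℝ (Fin n)) N]
    [IsManifold (𝓡 n) ∞ N]
    {M : Type*} [TopologicalSpace M] [T2Space M] [ChartedSpace (EuclideanSpace ℝ (Fin m)) M]
    [IsManifold (𝓡 m) ∞ M]
    (ι : N → M) (hι : Manifold.IsSmoothEmbedding (𝓡 n) (𝓡 m) ∞ ι)
    (Λ : JacobiGeometry.BivField m M) (E : JacobiGeometry.VField m M)
    (hJ : JacobiGeometry.IsJacobiStructure Λ E) :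
    (∀ ν : JacobiGeometry.Normalization n m ι,
      ν.IsAlmostDirac Λ ∨ ν.IsAJC Λ E ∨ ν.IsQuasiDirac Λ E ∨ ν.IsCoordQuasiDirac Λ E →
      JacobiGeometry.IsJacobiStructure (ν.inducedBivector hι Λ) (ν.inducedVector hι E)) ∧
    (∀ ν₁ ν₂ : JacobiGeometry.Normalization n m ι,
      ν₁.IsAlmostDirac Λ ∨ ν₁.IsAJC Λ E → ν₂.IsAlmostDirac Λ ∨ ν₂.IsAJC Λ E →
      ν₁.inducedBivector hι Λ = ν₂.inducedBivector hι Λ) :=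
  ⟨fun ν h ↦ ν.isJacobiStructure_induced hι hJ h, fun _ _ h₁ h₂ ↦
    JacobiGeometry.Normalization.inducedBivector_eq_of_compat hι hJ.isBivectorField
      (h₁.elim And.left And.left) (h₂.elim And.left And.left)⟩
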